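/- Let $G$ be a finite simple graph with $v$ vertices and edge set $E$, and let $\mathcal A_3=\mathbb Z[x]/(x^3)$, graded by $\deg x=1$. Chromatic (co)homology. Fix an ordering of the edges. For $s\subseteq E$ let $[G:s]$ be the graph with all vertices of $G$ and edge set $s$. The chromatic cochain complex is $C^i(G)=\bigoplus_{s\subseteq E,\,|s|=i}\mathcal A_3^{\otimes k(s)}$, with one tensor factor for each of the $k(s)$ components of $[G:s]$, and $d=\sum_{e\notin s}(-1)^{t(s,e)}d_e$. Here $d_e$ maps the summand of $s$ to the summand of $s\cup\{e\}$; it multiplies the two tensor factors of the components joined by $e$, or is the identity if $e$ joins no two different components; and $t(s,e)$ is the number of edges of $s$ before $e$. The differential preserves degree. Let $H^{i,j}_{\mathcal A_3}(G)$ be the cohomology of the degree $j$ part $C^{*,j}(G)$, $j\in\mathbb Z$, and let $H_{i,j}^{\mathcal A_3}(G)$ be the homology of the dual chain complex $\operatorname{Hom}(C^{*,j}(G),\mathbb Z)$. The cell complex. Let $X_{\Delta,4}$ be the cell complex obtained from $G$ by identifying all vertices, attaching one 2-cell along every 4-cycle of $G$, and attaching two 2-cells for every triangle of $G$: if $\vec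 e_1,\vec e_2,\vec e_3$ are the coherently oriented edges of the triangle, these are two of the three cells attached along $\vec e_i\,\vec e_{i-1}^{\,-1}\,\vec e_i\,\vec e_{i+1}^{\,-1}$ (indices mod 3), with boundary $2\vec e_i-\vec e_{i-1}-\vec e_{i+1}$. Its homology and cohomology are cellular. The numbers. Let $t_k$ be the number of 3-element sets of vertices joined by exactly $k$ edges, $d_2$ the number of ordered pairs of vertices at distance $2$, $d_{\ge 3}$ the number of ordered pairs of vertices at distance at least $3$ (possibly infinite), and $sq(G)$ the number of 4-cycles of $G$ (as subgraphs). Put $n=t_0+\frac{d_2}{2}+d_{\ge 3}$ and $r=t_2-\frac{d_2}{2}-sq(G)$. Then, for every choice made in these constructions: Theorem 4.1. (0) $H^{0,2v-3}_{\mathcal A_3}(G)$ is a free abelian group isomorphic to $H^1(X_{\Delta,4},\mathbb Z)\oplus\mathbb Z^{n}$. (1) $H^{1,2v-3}_{\mathcal A_3}(G)= H^2(X_{\Delta,4},\mathbb Z)\oplus\mathbb Z^{r}$. As $r$ may be negative, this means: both groups are finitely generated, they have isomorphic torsion subgroups, $\operatorname{rank}H^{1,2v-3}_{\mathcal A_3}(G)=\operatorname{rank}H^2(X_{\Delta,4},\mathbb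 Z)+r$, and $H^{1,2v-3}_{\mathcal A_3}(G)\oplus\mathbb Z^b\cong H^2(X_{\Delta,4},\mathbb Z)\oplus\mathbb Z^a$ for all integers $a,b\ge 0$ with $a-b=r$. Theorem 4.2 (homology form). (0) $H_{0,2v-3}^{\mathcal A_3}(G)\cong H_1(X_{\Delta,4},\mathbb Z)\oplus\mathbb Z^{n}$. (1) $H_{1,2v-3}^{\mathcal A_3}(G)$ is a finitely generated free abelian group, and it equals $H_2(X_{\Delta,4},\mathbb Z)\oplus\mathbb Z^{r}$, that is, $H_{1,2v-3}^{\mathcal A_3}(G)\oplus\mathbb Z^b\cong H_2(X_{\Delta,4},\mathbb Z)\oplus\mathbb Z^a$ for all integers $a,b\ge 0$ with $a-b=r$. -/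

import Mathlib

open scoped TensorProduct

noncomputable section

namespace ChromaticHomology

universe u

/-! ### Tensor powers of the truncated polynomial ring -/

/-- The ring `A_m = ℤ[x]/(x^m)`. -/
abbrev TruncPoly (m : ℕ) : Type :=
  Polynomial ℤ ⧸ Ideal.span {(Polynomial.X : Polynomial ℤ) ^ m}

/-- The class of `x` in `A_m`. -/
def TruncPoly.x (m : ℕ) : TruncPoly m := Ideal.Quotient.mk _ Polynomial.X

/-- The tensor power `A_m^{⊗ι}` over `ℤ`. -/
def TensorPow (m : ℕ) (ι : Type u) : Type u := ⨂[ℤ] _ : ι, TruncPoly m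

instance (m : ℕ) (ι : Type u) : AddCommGroup (TensorPow m ι) :=
  inferInstanceAs (AddCommGroup (⨂[ℤ] _ : ι, TruncPoly m))

/-- The pure tensor `⊗ a_i`. -/
def TensorPow.pure {m : ℕ} {ι : Type u} (a : ι → TruncPoly m) : TensorPow m ι :=
  PiTensorProduct.tprod ℤ a

section Merge

variable {ι κ : Type u} [Fintype ι]

open Classical in
theorem fiber_prod_update {A : Type} [CommRing A] (f : ι → κ) (a : ι → A) (i : ι) (z : A) :
    (fun k : κ => ∏ l ∈ Finset.univ.filter (fun l => f l = k), Function.update a i z l) =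
      Function.update (fun k : κ => ∏ l ∈ Finset.univ.filter (fun l => f l = k), a l) (f i)
        (z * ∏ l ∈ (Finset.univ.filter (fun l => f l = f i)).erase i, a l) := by
  funext k
  by_cases hk : k = f i
  · subst hk
    rw [Function.update_self, ← Finset.mul_prod_erase _ _
      (show i ∈ Finset.univ.filter (fun l => f l = f i) by simp), Function.update_self]
    congr 1
    refine Finset.prod_congr rfl fun l hl => ?_
    rw [Function.update_of_ne (Finset.ne_of_mem_erase hl)]
  · rw [Function.update_of_ne hk]
    refine Finset.prod_congr rfl fun l hl => ?_
    rw [Function.update_of_ne]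
    rintro rfl
    exact hk (by simpa using (Finset.mem_filter.1 hl).2.symm)

open Classical in
/-- For `f : ι → κ`, the linear map `A_m^{⊗ι} → A_m^{⊗κ}` that multiplies together the tensor
factors with indices in the same fibre of `f`. -/
def mergeMap (m : ℕ) (f : ι → κ) : TensorPow m ι →ₗ[ℤ] TensorPow m κ :=
  AddMonoidHom.toIntLinearMap <| LinearMap.toAddMonoidHom <|
    (PiTensorProduct.lift <| MultilinearMap.mk'
      (fun a : ι → TruncPoly m => PiTensorProduct.tprod ℤ
        (fun k : κ => ∏ i ∈ Finset.univ.filter (fun i => f i = k), a i))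
      (fun a i x y => by
        simp only [fiber_prod_update, add_mul, MultilinearMap.map_update_add])
      (fun a i c x => by
        simp only [fiber_prod_update, smul_mul_assoc, MultilinearMap.map_update_smul]) :
      (⨂[ℤ] _ : ι, TruncPoly m) →ₗ[ℤ] (⨂[ℤ] _ : κ, TruncPoly m))

open Classical in
theorem mergeMap_pure (m : ℕ) (f : ι → κ) (a : ι → TruncPoly m) :
    mergeMap m f (TensorPow.pure a) = TensorPow.pure
      (fun k : κ => ∏ i ∈ Finset.univ.filter (fun i => f i = k), a i) :=
  PiTensorProduct.lift.tprod a

/-- The part of degree `j` of `A_m^{⊗ι}` (where `x` has degree `1`): it is spanned by the pure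
tensors of monomials of total degree `j`. -/
def tensorDegree (m : ℕ) (ι : Type u) [Fintype ι] (j : ℤ) : Submodule ℤ (TensorPow m ι) :=
  Submodule.span ℤ {z | ∃ w : ι → ℕ, ∑ i, (w i : ℤ) = j ∧
    z = TensorPow.pure (fun i => TruncPoly.x m ^ w i)}

theorem mergeMap_mem_tensorDegree [Fintype κ] (m : ℕ) (f : ι → κ) (j : ℤ)
    {z : TensorPow m ι} (hz : z ∈ tensorDegree m ι j) :
    mergeMap m f z ∈ tensorDegree m κ j := by
  classical
  refine (Submodule.span_le (p := (tensorDegree m κ j).comap (mergeMap m f))).2 ?_ hz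
  rintro _ ⟨w, hw, rfl⟩
  refine Submodule.subset_span ⟨fun k => ∑ i ∈ Finset.univ.filter (fun i => f i = k), w i, ?_, ?_⟩
  · rw [← hw]
    push_cast
    exact Finset.sum_fiberwise Finset.univ f (fun i => (w i : ℤ))
  · rw [mergeMap_pure]
    congr 1
    funext k
    exact (Finset.prod_pow_eq_pow_sum _ _ _)

end Merge

/-! ### Chromatic graph cohomology and homology over `A_m` -/

section Graph

variable {V : Type u} (G : SimpleGraph V)

variable {G} in
open Classical in
/-- The edge set `s \ {e}`, for `e ∈ s`. -/
def face {i : ℕ} (s : {s : Finset G.edgeSet // s.card = i + 1}) (e : {e : G.edgeSet // e ∈ s.1}) :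
    {s : Finset G.edgeSet // s.card = i} :=
  ⟨s.1.erase e.1, by rw [Finset.card_erase_of_mem e.2, s.2, Nat.add_sub_cancel]⟩

variable {G} in
open Classical in
theorem face_subset {i : ℕ} (s : {s : Finset G.edgeSet // s.card = i + 1})
    (e : {e : G.edgeSet // e ∈ s.1}) : (face s e).1 ⊆ s.1 :=
  Finset.erase_subset _ _

variable [Fintype V]

/-- `[G : s]`: all vertices of `G`, and the edges in `s`. -/
def spanning (s : Finset G.edgeSet) : SimpleGraph V :=
  SimpleGraph.fromEdgeSet (Subtype.val '' (s : Set G.edgeSet))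

/-- The connected components of `[G : s]`. -/
abbrev Comp (s : Finset G.edgeSet) : Type u := (spanning G s).ConnectedComponent

instance (s : Finset G.edgeSet) : Fintype (Comp G s) := Fintype.ofFinite _

/-- The map of components induced by an inclusion of edge sets. -/
def compMap {s t : Finset G.edgeSet} (h : s ⊆ t) : Comp G s → Comp G t :=
  SimpleGraph.ConnectedComponent.map (SimpleGraph.Hom.ofLE
    (SimpleGraph.fromEdgeSet_mono (Set.image_mono (Finset.coe_subset.2 h))))

/-- The cochain group `C^i(G)`: the direct sum, over the sets `s` of `i` edges, of
`A_m^{⊗ k(s)}`, with one tensor factor for each component of `[G : s]`. -/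
abbrev Cochain (m i : ℕ) : Type u :=
  (s : {s : Finset G.edgeSet // s.card = i}) → TensorPow m (Comp G s.1)

open Classical in
/-- `t(s,e)`: the number of edges of `s` that precede `e` in the chosen ordering of the edges. -/
def precede (ord : G.edgeSet ↪ ℕ) (s : Finset G.edgeSet) (e : G.edgeSet) : ℕ :=
  (s.filter (fun f => ord f < ord e)).card

/-- The differential `d^i = ∑ (-1)^{t(s,e)} d_e`, written by its components: the summand `s`
receives the maps `d_e` from the summands `s \ {e}`, for `e ∈ s`.  If `e` joins two components
of `[G : s \ {e}]` then `d_e` multiplies the two corresponding tensor factors, otherwise it is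
the identity; `mergeMap` covers both cases. -/
def differential (ord : G.edgeSet ↪ ℕ) (m i : ℕ) : Cochain G m i →ₗ[ℤ] Cochain G m (i + 1) :=
  LinearMap.pi fun s => ∑ e : {e : G.edgeSet // e ∈ s.1},
    ((-1 : ℤ) ^ precede G ord (face s e).1 e.1) •
      (mergeMap m (compMap G (face_subset s e))).comp
        (LinearMap.proj (R := ℤ)
          (φ := fun s : {s : Finset G.edgeSet // s.card = i} => TensorPow m (Comp G s.1))
          (face s e))

theorem differential_apply (ord : G.edgeSet ↪ ℕ) (m i : ℕ) (y : Cochain G m i)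
    (s : {s : Finset G.edgeSet // s.card = i + 1}) :
    differential G ord m i y s = ∑ e : {e : G.edgeSet // e ∈ s.1},
      ((-1 : ℤ) ^ precede G ord (face s e).1 e.1) •
        mergeMap m (compMap G (face_subset s e)) (y (face s e)) := by
  simp only [differential, LinearMap.pi_apply, LinearMap.sum_apply, LinearMap.smul_apply,
    LinearMap.comp_apply, LinearMap.proj_apply]

/-- The part `C^{i,j}(G)` of degree `j` of `C^i(G)`. -/
def gradedCochain (m i : ℕ) (j : ℤ) : Submodule ℤ (Cochain G m i) :=
  Submodule.pi Set.univ fun s => tensorDegree m (Comp G s.1) j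

theorem differential_mem (ord : G.edgeSet ↪ ℕ) (m i : ℕ) (j : ℤ) (y : Cochain G m i)
    (hy : y ∈ gradedCochain G m i j) :
    differential G ord m i y ∈ gradedCochain G m (i + 1) j := by
  refine Submodule.mem_pi.2 fun s _ => ?_
  rw [differential_apply]
  exact Submodule.sum_mem _ fun e _ => Submodule.smul_mem _ _
    (mergeMap_mem_tensorDegree m _ j (Submodule.mem_pi.1 hy (face s e) (Set.mem_univ _)))

/-- The differential `d^{i,j} : C^{i,j}(G) → C^{i+1,j}(G)`. -/
def gradedDifferential (ord : G.edgeSet ↪ ℕ) (m i : ℕ) (j : ℤ) :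
    gradedCochain G m i j →ₗ[ℤ] gradedCochain G m (i + 1) j :=
  (differential G ord m i).restrict fun y hy => differential_mem G ord m i j y hy

/-- The coboundaries in `C^{i,j}(G)`; the complex is zero in negative cohomological degree. -/
def coboundaries (ord : G.edgeSet ↪ ℕ) (m : ℕ) :
    (i : ℕ) → (j : ℤ) → Submodule ℤ (gradedCochain G m i j)
  | 0, _ => ⊥
  | i + 1, j => LinearMap.range (gradedDifferential G ord m i j)

/-- Chromatic graph cohomology `H^{i,j}_{A_m}(G)`. -/
abbrev Cohomology (ord : G.edgeSet ↪ ℕ) (m i : ℕ) (j : ℤ) : Type u :=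
  LinearMap.ker (gradedDifferential G ord m i j) ⧸
    (coboundaries G ord m i j).submoduleOf (LinearMap.ker (gradedDifferential G ord m i j))

/-- The cycles in the chain group `C_{i,j}(G)`.  The chain complex is the dual of the complex
`C^{*,j}(G)`, so that its matrices are the transposed ones. -/
def cycles (ord : G.edgeSet ↪ ℕ) (m : ℕ) :
    (i : ℕ) → (j : ℤ) → Submodule ℤ (Module.Dual ℤ (gradedCochain G m i j))
  | 0, _ => ⊤
  | i + 1, j => LinearMap.ker (gradedDifferential G ord m i j).dualMap

/-- Chromatic graph homology `H_{i,j}^{A_m}(G)`. -/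
abbrev Homology (ord : G.edgeSet ↪ ℕ) (m i : ℕ) (j : ℤ) : Type u :=
  cycles G ord m i j ⧸
    (LinearMap.range (gradedDifferential G ord m i j).dualMap).submoduleOf (cycles G ord m i j)

end Graph

/-! ### Two-dimensional cell complexes -/

/-- A cell complex of dimension at most two.  A 1-cell `e` goes from `src e` to `tgt e`; a signed
1-cell `(e, true)` is `e` itself and `(e, false)` is `e` traversed backwards; a 2-cell is attached
along a closed path of signed 1-cells. -/
structure TwoComplex where
  Cell0 : Type u
  Cell1 : Type u
  Cell2 : Type u
  src : Cell1 → Cell0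
  tgt : Cell1 → Cell0
  attach : Cell2 → List (Cell1 × Bool)
  attach_chain : ∀ f, (attach f).IsChain fun p q =>
    (if p.2 then tgt p.1 else src p.1) = (if q.2 then src q.1 else tgt q.1)
  attach_closed : ∀ f, ∀ p ∈ (attach f).getLast?, ∀ q ∈ (attach f).head?,
    (if p.2 then tgt p.1 else src p.1) = (if q.2 then src q.1 else tgt q.1)

namespace TwoComplex

variable (X : TwoComplex.{u})

/-- The cellular boundary `∂₁ : C₁ → C₀`. -/
def boundary1 : (X.Cell1 →₀ ℤ) →ₗ[ℤ] (X.Cell0 →₀ ℤ) :=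
  Finsupp.linearCombination ℤ fun e =>
    Finsupp.single (X.tgt e) (1 : ℤ) - Finsupp.single (X.src e) (1 : ℤ)

/-- The cellular boundary `∂₂ : C₂ → C₁`. -/
def boundary2 : (X.Cell2 →₀ ℤ) →ₗ[ℤ] (X.Cell1 →₀ ℤ) :=
  Finsupp.linearCombination ℤ fun f =>
    ((X.attach f).map fun p => Finsupp.single p.1 (if p.2 then (1 : ℤ) else -1)).sum

/-- `H_1(X, ℤ)`. -/
abbrev homology1 : Type u :=
  LinearMap.ker X.boundary1 ⧸ (LinearMap.range X.boundary2).submoduleOf (LinearMap.ker X.boundary1)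

/-- `H_2(X, ℤ)`; there are no 3-cells. -/
abbrev homology2 : Type u := LinearMap.ker X.boundary2

/-- `H^1(X, ℤ)`. -/
abbrev cohomology1 : Type u :=
  LinearMap.ker X.boundary2.dualMap ⧸
    (LinearMap.range X.boundary1.dualMap).submoduleOf (LinearMap.ker X.boundary2.dualMap)

/-- `H^2(X, ℤ)`; there are no 3-cells. -/
abbrev cohomology2 : Type u :=
  Module.Dual ℤ (X.Cell2 →₀ ℤ) ⧸ LinearMap.range X.boundary2.dualMap

end TwoComplex

/-! ### The cell complex `X_{Δ,4}(G)` -/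

section CellComplex

variable {V : Type u} (G : SimpleGraph V)

/-- `(a, b, c, d)` runs around a 4-cycle of `G`. -/
def IsSquare (p : V × V × V × V) : Prop :=
  G.Adj p.1 p.2.1 ∧ G.Adj p.2.1 p.2.2.1 ∧ G.Adj p.2.2.1 p.2.2.2 ∧ G.Adj p.2.2.2 p.1 ∧
    p.1 ≠ p.2.2.1 ∧ p.2.1 ≠ p.2.2.2

/-- The set of edges of the closed path `(a, b, c, d)`. -/
def squareEdges (p : V × V × V × V) : Set (Sym2 V) :=
  {s(p.1, p.2.1), s(p.2.1, p.2.2.1), s(p.2.2.1, p.2.2.2), s(p.2.2.2, p.1)}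

/-- The 4-cycles of `G`, as subgraphs: a 4-cycle is given by its set of edges. -/
abbrev FourCycle : Type u := {S : Set (Sym2 V) // ∃ p, IsSquare G p ∧ squareEdges p = S}

/-- The triangles of `G`, given by their sets of vertices. -/
abbrev Triangle : Type u := {T : Finset V // G.IsNClique 3 T}

/-- The choices in the construction of `X_{Δ,4}(G)`: an orientation of every edge, a way of
running around every 4-cycle, and an ordering of the vertices of every triangle. -/
structure CellChoice where
  edge : G.edgeSet → V × V
  edge_spec : ∀ e, s((edge e).1, (edge e).2) = e.1
  square : FourCycle G → V × V × V × V
  square_spec : ∀ S, IsSquare G (square S) ∧ squareEdges (square S) = S.1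
  triangle : Triangle G → V × V × V
  triangle_spec : ∀ T v, v ∈ T.1 ↔
    v = (triangle T).1 ∨ v = (triangle T).2.1 ∨ v = (triangle T).2.2

/-- Such choices exist for every graph. -/
instance : Nonempty (CellChoice G) := by
  classical
  have h1 : ∀ e : G.edgeSet, ∃ p : V × V, s(p.1, p.2) = e.1 := by
    rintro ⟨e, _⟩
    induction e with
    | h a b => exact ⟨(a, b), rfl⟩
  have h3 : ∀ T : Triangle G, ∃ p : V × V × V, ∀ v, v ∈ T.1 ↔ v = p.1 ∨ v = p.2.1 ∨ v = p.2.2 := by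
    rintro ⟨T, hT⟩
    obtain ⟨a, b, c, -, -, -, rfl⟩ := Finset.card_eq_three.1 hT.card_eq
    exact ⟨(a, b, c), by simp⟩
  choose f hf using h1
  choose g hg using h3
  choose k hk using fun S : FourCycle G => S.2
  exact ⟨⟨f, hf, k, hk, g, hg⟩⟩

variable {G}

namespace CellChoice

variable (c : CellChoice G)

theorem triangle_adj (T : Triangle G) :
    G.Adj (c.triangle T).1 (c.triangle T).2.1 ∧ G.Adj (c.triangle T).2.1 (c.triangle T).2.2 ∧
      G.Adj (c.triangle T).2.2 (c.triangle T).1 := by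
  classical
  have h := c.triangle_spec T
  have hT : T.1 = {(c.triangle T).1, (c.triangle T).2.1, (c.triangle T).2.2} := by
    ext v
    simp [h v]
  have h2 := T.2
  rw [hT, SimpleGraph.is3Clique_triple_iff] at h2
  exact ⟨h2.1, h2.2.2, h2.2.1.symm⟩

open Classical in
/-- The edge from `a` to `b`, as a signed 1-cell. -/
def step {a b : V} (h : G.Adj a b) : G.edgeSet × Bool :=
  (⟨s(a, b), h⟩, decide (c.edge ⟨s(a, b), h⟩ = (a, b)))

/-- The path along which a 2-cell is attached.  A 4-cycle `a b c d` carries one 2-cell, attached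
along it.  A triangle `a b c`, with edges `e₁ = ab`, `e₂ = bc`, `e₃ = ca`, carries two: one attached
along `e₃ e₂⁻¹ e₃ e₁⁻¹`, with boundary `2e₃ - e₂ - e₁`, and one attached along `e₁ e₃⁻¹ e₁ e₂⁻¹`,
with boundary `2e₁ - e₃ - e₂`. -/
def attachPath : FourCycle G ⊕ Triangle G × Bool → List (G.edgeSet × Bool)
  | .inl S =>
    have h := (c.square_spec S).1
    [c.step h.1, c.step h.2.1, c.step h.2.2.1, c.step h.2.2.2.1]
  | .inr (T, true) =>
    have h := c.triangle_adj T
    [c.step h.2.2, c.step h.2.1.symm, c.step h.2.2, c.step h.1.symm]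
  | .inr (T, false) =>
    have h := c.triangle_adj T
    [c.step h.1, c.step h.2.2.symm, c.step h.1, c.step h.2.1.symm]

/-- The cell complex `X_{Δ,4}(G)`.  All vertices of `G` are identified: `Trunc V` is the quotient
of `V` by the relation that always holds. -/
def cellComplex : TwoComplex.{u} where
  Cell0 := Trunc V
  Cell1 := G.edgeSet
  Cell2 := FourCycle G ⊕ Triangle G × Bool
  src e := Trunc.mk (c.edge e).1
  tgt e := Trunc.mk (c.edge e).2
  attach := c.attachPath
  attach_chain f := by
    have : ∀ l : List (G.edgeSet × Bool), l.IsChain fun p q =>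
        (if p.2 then (Trunc.mk (c.edge p.1).2) else (Trunc.mk (c.edge p.1).1)) =
          (if q.2 then (Trunc.mk (c.edge q.1).1) else (Trunc.mk (c.edge q.1).2)) := by
      intro l
      induction l with
      | nil => exact List.IsChain.nil
      | cons a l ih =>
        cases l with
        | nil => exact List.IsChain.singleton a
        | cons b l => exact List.IsChain.cons_cons (Subsingleton.elim _ _) ih
    exact this _
  attach_closed _ _ _ _ _ := Subsingleton.elim _ _

end CellChoice

/-! ### The numbers in the formulas -/

variable (G)

/-- `t_k`: the number of (unordered) triples of distinct vertices joined by exactly `k` edges. -/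
def tripleCount (k : ℕ) : ℕ :=
  {T : Finset V | T.card = 3 ∧ {e ∈ G.edgeSet | ∀ v ∈ e, v ∈ T}.ncard = k}.ncard

/-- `d_2`: the number of ordered pairs of vertices at distance two.  It is even. -/
def distTwoCount : ℕ := {p : V × V | G.edist p.1 p.2 = 2}.ncard

/-- `d_{≥3}`: the number of ordered pairs of vertices at distance at least three; vertices in
different components are at infinite distance. -/
def distGeThreeCount : ℕ := {p : V × V | 3 ≤ G.edist p.1 p.2}.ncard

/-- `sq(G)`: the number of 4-cycles. -/
def squareCount : ℕ := Nat.card (FourCycle G)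

end CellComplex

end ChromaticHomology

end

noncomputable section

namespace ChromaticHomology

universe u

/-! Call the deficit of an exponent vector the amount by which it falls short of exponent 2 in every
tensor factor. In degree 2v-3 the total deficit is 3 for the empty edge set and 1 for a single edge;
it would be negative for two edges, which leave at most v-2 components (`gradedCochain_two_eq_bot`).
So only d : C^0 → C^1 matters, and the four chromatic groups are the kernels and cokernels of d and
of its dual.

A basis of C^0 consists of triples T_abc (deficits 1, 1, 1) and ordered pairs P_ab (deficit 2 at a,
1 at b); a basis of C^1 consists of an edge together with the component that has deficit 1. Reading
off the matrix of d (`range_dualMap_differential`), the cokernel of the dual map has generators T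
and P and, for every edge ab, the relations P_ab + P_ba = 0 and T_abc + P_ac + P_bc = 0 for c
outside the edge. The second kind eliminates T_abc whenever the triple contains an edge. A path
a-p-b gives two expressions for one T, hence P_ab - P_ba = P_pa - P_pb. If ab is an edge, this is
the triangle relation 2 P_ab = P_bp + P_pa; two midpoints of the same pair give the 4-cycle
relation; for a pair at distance two, one of its two orders is eliminated. What remains is H_1 of
the cell complex, generated by the P of edges, plus a free generator for every edgeless triple, for
one order of each pair at distance two, and for both orders of each pair further apart. This is
`nonempty_presentation_equiv`.

The other three groups follow by linear algebra over ℤ: a map of finitely generated free groups and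
its dual have cokernels with the same torsion (`exists_cokernel_equiv`), and kernels are free, hence
known from their rank. `homology_compare` carries this out; the ranks come from an Euler
characteristic count, `rank_identity`. -/

/-! ### Kernels and cokernels of maps of finitely generated free abelian groups -/

theorem finrank_range_add_finrank_ker_int {M N : Type*} [AddCommGroup M] [AddCommGroup N]
    [Module.Finite ℤ M] (f : M →ₗ[ℤ] N) :
    Module.finrank ℤ (LinearMap.range f) + Module.finrank ℤ (LinearMap.ker f) =
      Module.finrank ℤ M := by
  rw [← f.quotKerEquivRange.finrank_eq, Submodule.finrank_quotient_add_finrank]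

open Module in
/-- The cokernel of a map of finitely generated free abelian groups and that of its dual have the
same torsion. -/
theorem exists_cokernel_equiv {M N : Type*} [AddCommGroup M] [AddCommGroup N]
    [Module.Free ℤ M] [Module.Finite ℤ M] [Module.Free ℤ N] [Module.Finite ℤ N] (f : M →ₗ[ℤ] N) :
    ∃ (Q : Type) (_ : AddCommGroup Q) (k l : ℕ), Module.IsTorsion ℤ Q ∧
      k + finrank ℤ (LinearMap.range f) = finrank ℤ N ∧
      l + finrank ℤ (LinearMap.range f) = finrank ℤ M ∧
      Nonempty ((N ⧸ LinearMap.range f) ≃ₗ[ℤ] Q × (Fin k → ℤ)) ∧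
      Nonempty ((Dual ℤ M ⧸ LinearMap.range f.dualMap) ≃ₗ[ℤ] Q × (Fin l → ℤ)) := by
  classical
  -- Smith normal form: the image of `f` has a basis of multiples `a i` of some members `g i` of a
  -- basis of `N`.
  obtain ⟨n, bM, bN, g, a, hsnf⟩ :=
    Submodule.smithNormalForm (Module.Free.chooseBasis ℤ N) (LinearMap.range f)
  have ha : ∀ i, a i ≠ 0 := by
    intro i hi
    have h := hsnf i
    rw [hi, zero_smul] at h
    exact bN.ne_zero i (Subtype.ext h)
  -- The common torsion group; it is finite because no `a i` vanishes.
  let Q : Type := ∀ i : Fin n, ZMod (a i).natAbs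
  have hne : ∀ i, NeZero (a i).natAbs := fun i => ⟨Int.natAbs_ne_zero.2 (ha i)⟩
  have hdvd : ∀ i (z : ℤ), ((z : ℤ) : ZMod (a i).natAbs) = 0 ↔ a i ∣ z := by
    intro i z
    rw [ZMod.intCast_zmod_eq_zero_iff_dvd, Int.natAbs_dvd]
  have hQ : Module.IsTorsion ℤ Q := by
    rw [← isAddTorsion_iff_isTorsion_int]
    exact isAddTorsion_of_finite
  have hfin : finrank ℤ (LinearMap.range f) = n := by
    rw [finrank_eq_card_basis bN, Fintype.card_fin]
  have hcard : Fintype.card {i // i ∉ Set.range g} + n = finrank ℤ N := by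
    rw [finrank_eq_card_basis bM, Fintype.card_subtype_compl]
    have h1 : Fintype.card {i // i ∈ Set.range g} = n :=
      (Fintype.card_congr (Equiv.ofInjective g g.injective)).symm.trans (Fintype.card_fin n)
    have h2 := Fintype.card_subtype_le (fun i => i ∈ Set.range g)
    rw [h1] at h2 ⊢
    omega
  have hker : finrank ℤ (LinearMap.ker f) + n = finrank ℤ M := by
    have := finrank_range_add_finrank_ker_int f
    omega
  let c (i : Fin n) : ℤ →ₗ[ℤ] ZMod (a i).natAbs := (Int.castAddHom _).toIntLinearMap
  -- Coordinates along the image are reduced modulo `a i`, the remaining ones are kept; the kernel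
  -- is the image of `f`.
  let g1 : N →ₗ[ℤ] Q × ({i // i ∉ Set.range g} → ℤ) :=
    LinearMap.prod (LinearMap.pi fun i => (c i).comp (bM.coord (g i)))
      (LinearMap.pi fun i => bM.coord i.1)
  have hg1 : Function.Surjective g1 := by
    rintro ⟨q, t⟩
    choose z hz using fun i => ZMod.intCast_surjective (q i)
    let y : Module.Free.ChooseBasisIndex ℤ N → ℤ := fun i =>
      if h : i ∈ Set.range g then z h.choose else t ⟨i, h⟩
    refine ⟨bM.equivFun.symm y, Prod.ext (funext fun i => ?_) (funext fun i => ?_)⟩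
    · have h : g i ∈ Set.range g := ⟨i, rfl⟩
      have h' : h.choose = i := g.injective h.choose_spec
      have : bM.repr (bM.equivFun.symm y) (g i) = z i := by
        rw [← bM.equivFun_apply, LinearEquiv.apply_symm_apply]
        simp only [y, dif_pos h, h']
      change ((bM.repr (bM.equivFun.symm y) (g i) : ℤ) : ZMod (a i).natAbs) = q i
      rw [this, hz]
    · change bM.repr (bM.equivFun.symm y) i.1 = t i
      rw [← bM.equivFun_apply, LinearEquiv.apply_symm_apply]
      simp only [y, dif_neg i.2]
  have hg1k : LinearMap.ker g1 = LinearMap.range f := by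
    apply le_antisymm
    · intro x hx
      have h1 : ∀ i, a i ∣ bM.repr x (g i) := fun i =>
        (hdvd i _).1 (congrFun (congrArg Prod.fst (LinearMap.mem_ker.1 hx)) i)
      have h2 : ∀ i, i ∉ Set.range g → bM.repr x i = 0 := fun i hi =>
        congrFun (congrArg Prod.snd (LinearMap.mem_ker.1 hx)) ⟨i, hi⟩
      choose z hz using h1
      have : x = ((∑ i, z i • bN i : LinearMap.range f) : N) := by
        conv_lhs => rw [← bM.sum_repr x]
        rw [Submodule.coe_sum, ← Finset.sum_subset (Finset.subset_univ (Finset.univ.map g)),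
          Finset.sum_map]
        · refine Finset.sum_congr rfl fun i _ => ?_
          rw [hz i, Submodule.coe_smul, hsnf i, smul_smul, mul_comm]
        · intro i _ hi
          rw [h2 i (by simpa using hi), zero_smul]
      rw [this]
      exact Subtype.property _
    · intro x hx
      have h : (LinearMap.range f).subtype.range ≤ LinearMap.ker g1 := by
        rw [LinearMap.range_le_ker_iff]
        refine bN.ext fun i => Prod.ext (funext fun j => ?_) (funext fun j => ?_)
        · change ((bM.repr (bN i : N) (g j) : ℤ) : ZMod (a j).natAbs) = 0
          rw [hsnf, hdvd, map_smul, Finsupp.smul_apply, bM.repr_self, Finsupp.single_apply]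
          split_ifs with hij
          · rw [g.injective hij]; simp
          · simp
        · change bM.repr (bN i : N) j.1 = 0
          rw [hsnf, map_smul, Finsupp.smul_apply, bM.repr_self, Finsupp.single_apply, if_neg,
            smul_zero]
          intro hij
          exact j.2 ⟨i, hij⟩
      exact h ⟨⟨x, hx⟩, rfl⟩
  -- The image is free, so `f` splits over it and `M` is the sum of the kernel and of `σ (bN i)`. A
  -- functional factors through `f` exactly when it kills the kernel and its value at each `σ (bN
  -- i)` is divisible by `a i`; `g2` records these two obstructions.
  obtain ⟨σ, hσ⟩ := f.rangeRestrict.exists_rightInverse_of_surjective f.range_rangeRestrict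
  have hσ' : ∀ y, f (σ y) = y := fun y => congrArg Subtype.val (LinearMap.congr_fun hσ y)
  let g2 : Dual ℤ M →ₗ[ℤ] Q × Dual ℤ (LinearMap.ker f) :=
    LinearMap.prod (LinearMap.pi fun i => (c i).comp (LinearMap.applyₗ (σ (bN i))))
      (LinearMap.ker f).subtype.dualMap
  have hg2 : Function.Surjective g2 := by
    rintro ⟨q, ψ⟩
    choose z hz using fun i => ZMod.intCast_surjective (q i)
    let p : M →ₗ[ℤ] LinearMap.ker f := LinearMap.codRestrict _
      (LinearMap.id - σ.comp f.rangeRestrict) (fun m => by simp [hσ'])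
    have hp1 : ∀ y, p (σ y) = 0 := by
      intro y
      refine Subtype.ext ?_
      have : f.rangeRestrict (σ y) = y := LinearMap.congr_fun hσ y
      simp [p, this]
    have hp2 : ∀ y : LinearMap.ker f, p y = y := by
      intro y
      refine Subtype.ext ?_
      have : f.rangeRestrict y = 0 := Subtype.ext y.2
      simp [p, this]
    refine ⟨(bN.constr ℤ z).comp f.rangeRestrict + ψ.comp p,
      Prod.ext (funext fun i => ?_) (LinearMap.ext fun y => ?_)⟩
    · change (((bN.constr ℤ z) (f.rangeRestrict (σ (bN i))) + ψ (p (σ (bN i))) : ℤ) :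
        ZMod (a i).natAbs) = q i
      have : f.rangeRestrict (σ (bN i)) = bN i := LinearMap.congr_fun hσ _
      rw [hp1, map_zero, add_zero, this, Basis.constr_basis, hz]
    · change (bN.constr ℤ z) (f.rangeRestrict y) + ψ (p y) = ψ y
      have : f.rangeRestrict y = 0 := Subtype.ext y.2
      rw [this, map_zero, zero_add, hp2]
  have hg2k : LinearMap.ker g2 = LinearMap.range f.dualMap := by
    apply le_antisymm
    · intro φ hφ
      have h1 : ∀ i, a i ∣ φ (σ (bN i)) := fun i =>
        (hdvd i _).1 (congrFun (congrArg Prod.fst (LinearMap.mem_ker.1 hφ)) i)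
      have h2 : ∀ y, f y = 0 → φ y = 0 := fun y hy =>
        LinearMap.congr_fun (congrArg Prod.snd (LinearMap.mem_ker.1 hφ)) ⟨y, hy⟩
      choose z hz using h1
      -- The quotients of `φ (σ (bN i))` by `a i` are prescribed on the basis vectors `bM (g i)`;
      -- the other values are arbitrary, here zero.
      let ψ : Dual ℤ N := bM.constr ℤ fun i => if h : i ∈ Set.range g then z h.choose else 0
      have hψ : ∀ i, ψ (bM (g i)) = z i := by
        intro i
        have h : g i ∈ Set.range g := ⟨i, rfl⟩
        have h' : h.choose = i := g.injective h.choose_spec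
        simp only [ψ, Basis.constr_basis, dif_pos h, h']
      have key : ψ.comp (LinearMap.range f).subtype = φ.comp σ := by
        refine bN.ext fun i => ?_
        rw [LinearMap.comp_apply, LinearMap.comp_apply, Submodule.subtype_apply, hsnf, map_smul,
          hψ, hz, smul_eq_mul]
      refine ⟨ψ, LinearMap.ext fun m => ?_⟩
      have h3 := LinearMap.congr_fun key (f.rangeRestrict m)
      have h4 := h2 (m - σ (f.rangeRestrict m)) (by rw [map_sub, hσ']; simp)
      rw [map_sub, sub_eq_zero] at h4
      rw [h4]
      exact h3
    · rintro _ ⟨ψ, rfl⟩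
      refine LinearMap.mem_ker.2 (Prod.ext (funext fun i => ?_) (LinearMap.ext fun y => ?_))
      · change ((ψ (f (σ (bN i))) : ℤ) : ZMod (a i).natAbs) = 0
        rw [hσ', hsnf, hdvd, map_smul, smul_eq_mul]
        exact dvd_mul_right _ _
      · change ψ (f y) = 0
        rw [LinearMap.mem_ker.1 y.2, map_zero]
  refine ⟨Q, inferInstance, Fintype.card {i // i ∉ Set.range g}, finrank ℤ (LinearMap.ker f), hQ,
    by rw [hfin, hcard], by rw [hfin, hker], ⟨?_⟩, ⟨?_⟩⟩
  · exact (Submodule.quotEquivOfEq _ _ hg1k.symm).trans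
      ((LinearMap.quotKerEquivOfSurjective g1 hg1).trans
        ((LinearEquiv.refl ℤ Q).prodCongr
          (LinearEquiv.funCongrLeft ℤ ℤ (Fintype.equivFin _).symm)))
  · exact (Submodule.quotEquivOfEq _ _ hg2k.symm).trans
      ((LinearMap.quotKerEquivOfSurjective g2 hg2).trans
        ((LinearEquiv.refl ℤ Q).prodCongr
          (finBasis ℤ (LinearMap.ker f)).dualBasis.equivFun))

/-- The torsion of the product of a torsion group and a free group. -/
theorem nonempty_torsion_equiv {A Q : Type*} [AddCommGroup A] [AddCommGroup Q] {k : ℕ}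
    (hQ : Module.IsTorsion ℤ Q) (e : A ≃ₗ[ℤ] Q × (Fin k → ℤ)) :
    Nonempty (Submodule.torsion ℤ A ≃ₗ[ℤ] Q) := by
  have key : ∀ x : A, x ∈ Submodule.torsion ℤ A ↔ (e x).2 = 0 := by
    intro x
    rw [Submodule.mem_torsion_iff]
    constructor
    · rintro ⟨a, ha⟩
      have h : (a : ℤ) • (e x).2 = 0 := by
        have h := congrArg (fun y => (e y).2) ha
        simpa [Submonoid.smul_def] using h
      exact (smul_eq_zero.1 h).resolve_left (nonZeroDivisors.ne_zero a.2)
    · intro h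
      obtain ⟨a, ha⟩ := @hQ (e x).1
      refine ⟨a, e.injective ?_⟩
      rw [map_zero, Submonoid.smul_def, map_smul]
      exact Prod.ext ha (by rw [Prod.smul_snd, h, smul_zero]; rfl)
  refine ⟨LinearEquiv.ofBijective
    ((LinearMap.fst ℤ Q (Fin k → ℤ)).comp (e.toLinearMap.comp (Submodule.torsion ℤ A).subtype))
    ⟨fun x y h => Subtype.ext (e.injective (Prod.ext h ?_)), fun q => ?_⟩⟩
  · rw [(key x).1 x.2, (key y).1 y.2]
  · refine ⟨⟨e.symm (q, 0), (key _).2 (by simp)⟩, by simp⟩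

theorem finrank_of_equiv_torsion_prod {A Q : Type*} [AddCommGroup A] [AddCommGroup Q] {k : ℕ}
    [Module.Finite ℤ A] (hQ : Module.IsTorsion ℤ Q) (e : A ≃ₗ[ℤ] Q × (Fin k → ℤ)) :
    Module.finrank ℤ A = k := by
  let p : A →ₗ[ℤ] (Fin k → ℤ) := (LinearMap.snd ℤ Q (Fin k → ℤ)).comp e.toLinearMap
  have hp : LinearMap.range p = ⊤ := LinearMap.range_eq_top.2
    (Prod.snd_surjective.comp e.surjective)
  have hk : Module.finrank ℤ (LinearMap.ker p) = 0 := by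
    rw [Module.finrank_eq_zero_iff_isTorsion]
    rintro ⟨x, hx⟩
    obtain ⟨a, ha⟩ := @hQ (e x).1
    refine ⟨a, Subtype.ext (e.injective ?_)⟩
    rw [Submonoid.smul_def, Submodule.coe_smul, map_smul, ZeroMemClass.coe_zero, map_zero]
    refine Prod.ext ha ?_
    have : (e x).2 = 0 := hx
    rw [Prod.smul_snd, this, smul_zero]; rfl
  have := finrank_range_add_finrank_ker_int p
  rw [hk, hp, finrank_top, Module.finrank_fin_fun] at this
  omega

open Module in
theorem nonempty_linearEquiv_of_finrank_eq_int {A B : Type*} [AddCommGroup A] [Module.Free ℤ A]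
    [Module.Finite ℤ A] [AddCommGroup B] [Module.Free ℤ B] [Module.Finite ℤ B]
    (h : finrank ℤ A = finrank ℤ B) : Nonempty (A ≃ₗ[ℤ] B) :=
  ⟨LinearEquiv.ofFinrankEq A B h⟩

open Module in
theorem finrank_dual_int (M : Type*) [AddCommGroup M] [Module.Free ℤ M] [Module.Finite ℤ M] :
    finrank ℤ (Dual ℤ M) = finrank ℤ M :=
  (Module.Free.chooseBasis ℤ M).toDualEquiv.finrank_eq.symm

def finProdEquiv (k n : ℕ) : ((Fin k → ℤ) × (Fin n → ℤ)) ≃ₗ[ℤ] (Fin (k + n) → ℤ) :=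
  (LinearEquiv.sumArrowLequivProdArrow (Fin k) (Fin n) ℤ ℤ).symm.trans
    (LinearEquiv.funCongrLeft ℤ ℤ finSumFinEquiv.symm)

theorem nonempty_prod_equiv {A Q : Type*} [AddCommGroup A] [AddCommGroup Q] {k : ℕ}
    (e : A ≃ₗ[ℤ] Q × (Fin k → ℤ)) (n : ℕ) :
    Nonempty ((A × (Fin n → ℤ)) ≃ₗ[ℤ] Q × (Fin (k + n) → ℤ)) := by
  let f : (Q × ((Fin k → ℤ) × (Fin n → ℤ))) ≃ₗ[ℤ] Q × (Fin (k + n) → ℤ) :=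
    (LinearEquiv.refl ℤ Q).prodCongr (finProdEquiv k n)
  exact ⟨(e.prodCongr (LinearEquiv.refl ℤ (Fin n → ℤ))).trans
    ((LinearEquiv.prodAssoc ℤ Q (Fin k → ℤ) (Fin n → ℤ)).trans f)⟩

/-- Both sides become the same torsion part times a free group of the same rank. The two paddings
`n` and `n'` make room for a rank difference of either sign. -/
theorem nonempty_prod_equiv_prod {A A' Q Q' : Type*} [AddCommGroup A] [AddCommGroup Q]
    [AddCommGroup A'] [AddCommGroup Q'] {k k' : ℕ} (e : A ≃ₗ[ℤ] Q × (Fin k → ℤ))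
    (e' : A' ≃ₗ[ℤ] Q' × (Fin k' → ℤ)) (q : Q ≃ₗ[ℤ] Q') {n n' : ℕ} (h : k + n = k' + n') :
    Nonempty ((A × (Fin n → ℤ)) ≃ₗ[ℤ] A' × (Fin n' → ℤ)) := by
  obtain ⟨f⟩ := nonempty_prod_equiv e n
  obtain ⟨f'⟩ := nonempty_prod_equiv e' n'
  rw [← h] at f'
  exact ⟨f.trans ((q.prodCongr (LinearEquiv.refl ℤ _)).trans f'.symm)⟩

open Module in
/-- The (co)homology of two complexes `C₀ → C₁` and `E^* → F^*` of free groups is determined, up to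
the ranks, by the cokernels of the dual maps. -/
theorem homology_compare {C D E F : Type*} [AddCommGroup C] [AddCommGroup D] [AddCommGroup E]
    [AddCommGroup F] [Module.Free ℤ C] [Module.Finite ℤ C] [Module.Free ℤ D] [Module.Finite ℤ D]
    [Module.Free ℤ E] [Module.Finite ℤ E] [Module.Free ℤ F] [Module.Finite ℤ F]
    (d : C →ₗ[ℤ] D) (b : F →ₗ[ℤ] E) (n : ℕ) (r : ℤ)
    (e : (Dual ℤ C ⧸ LinearMap.range d.dualMap) ≃ₗ[ℤ] (E ⧸ LinearMap.range b) × (Fin n → ℤ))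
    (hr : (finrank ℤ D : ℤ) - finrank ℤ C + finrank ℤ E + n = finrank ℤ F + r) :
    Nonempty (LinearMap.ker d ≃ₗ[ℤ] LinearMap.ker b.dualMap × (Fin n → ℤ)) ∧
    Nonempty (Submodule.torsion ℤ (D ⧸ LinearMap.range d) ≃ₗ[ℤ]
      Submodule.torsion ℤ (Dual ℤ F ⧸ LinearMap.range b.dualMap)) ∧
    (finrank ℤ (D ⧸ LinearMap.range d) : ℤ) =
      finrank ℤ (Dual ℤ F ⧸ LinearMap.range b.dualMap) + r ∧
    (∀ k l : ℕ, (k : ℤ) - l = r → Nonempty (((D ⧸ LinearMap.range d) × (Fin l → ℤ)) ≃ₗ[ℤ]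
      (Dual ℤ F ⧸ LinearMap.range b.dualMap) × (Fin k → ℤ))) ∧
    ∀ k l : ℕ, (k : ℤ) - l = r → Nonempty ((LinearMap.ker d.dualMap × (Fin l → ℤ)) ≃ₗ[ℤ]
      LinearMap.ker b × (Fin k → ℤ)) := by
  obtain ⟨Q, _, k, l, hQ, hk, hl, ⟨e1⟩, ⟨e2⟩⟩ := exists_cokernel_equiv d
  obtain ⟨Q', _, k', l', hQ', hk', hl', ⟨e1'⟩, ⟨e2'⟩⟩ := exists_cokernel_equiv b
  obtain ⟨e3⟩ : Nonempty ((Dual ℤ C ⧸ LinearMap.range d.dualMap) ≃ₗ[ℤ]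
      Q' × (Fin (k' + n) → ℤ)) := by
    obtain ⟨f⟩ := nonempty_prod_equiv e1' n
    exact ⟨e.trans f⟩
  obtain ⟨t⟩ := nonempty_torsion_equiv hQ e2
  obtain ⟨t'⟩ := nonempty_torsion_equiv hQ' e3
  -- `Q` is the torsion of both cokernels for `d`, `Q'` of both cokernels for `b`; the hypothesis
  -- `e` links the two pairs.
  let q : Q ≃ₗ[ℤ] Q' := t.symm.trans t'
  obtain ⟨u⟩ := nonempty_torsion_equiv hQ e1
  obtain ⟨u'⟩ := nonempty_torsion_equiv hQ' e2'
  have hl3 : l = k' + n :=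
    (finrank_of_equiv_torsion_prod hQ e2).symm.trans (finrank_of_equiv_torsion_prod hQ' e3)
  have r1 := finrank_of_equiv_torsion_prod hQ e1
  have r2 := finrank_of_equiv_torsion_prod hQ' e2'
  have k1 := finrank_range_add_finrank_ker_int d
  have k2 := finrank_range_add_finrank_ker_int b
  have k3 := finrank_range_add_finrank_ker_int d.dualMap
  have k4 := finrank_range_add_finrank_ker_int b.dualMap
  have c1 := Submodule.finrank_quotient_add_finrank (LinearMap.range d.dualMap)
  have c2 := Submodule.finrank_quotient_add_finrank (LinearMap.range b.dualMap)
  have r3 := finrank_of_equiv_torsion_prod hQ e2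
  have d1 := finrank_dual_int C
  have d2 := finrank_dual_int D
  have d3 := finrank_dual_int E
  have d4 := finrank_dual_int F
  -- The ranks of the cokernels of `d` and of `b.dualMap` differ by `r`: this is where the Euler
  -- characteristic hypothesis `hr` enters.
  have hlk : ∀ i j : ℕ, (i : ℤ) - j = r → k + j = l' + i := by
    intro i j hij
    omega
  refine ⟨?_, ⟨u.trans (q.trans u'.symm)⟩, ?_, ?_, ?_⟩
  -- Kernels are subgroups of free groups, hence free, so equality of ranks suffices.
  · refine nonempty_linearEquiv_of_finrank_eq_int ?_
    rw [finrank_prod, finrank_fin_fun]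
    omega
  · omega
  · intro i j hij
    exact nonempty_prod_equiv_prod e1 e2' q (hlk i j hij)
  · intro i j hij
    refine nonempty_linearEquiv_of_finrank_eq_int ?_
    rw [finrank_prod, finrank_prod, finrank_fin_fun, finrank_fin_fun]
    have := hlk i j hij
    omega

/-! ### Monomial bases of the graded tensor powers and cochain groups -/

/-- The coefficient of `x ^ k`. -/
def TruncPoly.coeff (m k : ℕ) : TruncPoly m →+ ℤ :=
  (Polynomial.lcoeff ℤ k).toAddMonoidHom.comp
    (AdjoinRoot.modByMonicHom (Polynomial.monic_X_pow (R := ℤ) m)).toAddMonoidHom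

/-- The coefficient is read from the remainder modulo `X ^ m`, which is `X ^ w` for `w < m` and zero
otherwise; `k < m` excludes a match in the second case. -/
theorem TruncPoly.coeff_x_pow {m k : ℕ} (hk : k < m) (w : ℕ) :
    TruncPoly.coeff m k (TruncPoly.x m ^ w) = if w = k then 1 else 0 := by
  have h : TruncPoly.coeff m k (TruncPoly.x m ^ w) =
      ((Polynomial.X ^ w : Polynomial ℤ) %ₘ Polynomial.X ^ m).coeff k :=
    congrArg (fun p => Polynomial.coeff p k) (AdjoinRoot.modByMonicHom_mk
      (Polynomial.monic_X_pow (R := ℤ) m) (Polynomial.X ^ w))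
  rw [h]
  rcases lt_or_ge w m with hw | hw
  · rw [(Polynomial.modByMonic_eq_self_iff (Polynomial.monic_X_pow m)).2, Polynomial.coeff_X_pow]
    · simp only [eq_comm]
    · rw [Polynomial.degree_X_pow, Polynomial.degree_X_pow]
      exact_mod_cast hw
  · rw [(Polynomial.modByMonic_eq_zero_iff_dvd (Polynomial.monic_X_pow m)).2 (pow_dvd_pow _ hw),
      Polynomial.coeff_zero, if_neg (by omega)]

theorem TruncPoly.x_pow_eq_zero {m w : ℕ} (h : m ≤ w) : TruncPoly.x m ^ w = 0 := by
  rw [TruncPoly.x, ← map_pow, Ideal.Quotient.eq_zero_iff_mem, Ideal.mem_span_singleton]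
  exact pow_dvd_pow _ h

/-- The coefficient of the monomial with exponents `W`. -/
def TensorPow.coord (m : ℕ) {ι : Type u} [Fintype ι] (W : ι → ℕ) : TensorPow m ι →ₗ[ℤ] ℤ :=
  AddMonoidHom.toIntLinearMap <| LinearMap.toAddMonoidHom <|
    (PiTensorProduct.lift ((MultilinearMap.mkPiAlgebra ℤ ι ℤ).compLinearMap
      (fun i => (TruncPoly.coeff m (W i)).toIntLinearMap)) :
      (⨂[ℤ] _ : ι, TruncPoly m) →ₗ[ℤ] ℤ)

theorem TensorPow.coord_pure {m : ℕ} {ι : Type u} [Fintype ι] (W : ι → ℕ)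
    (a : ι → TruncPoly m) :
    TensorPow.coord m W (TensorPow.pure a) = ∏ i, TruncPoly.coeff m (W i) (a i) :=
  (PiTensorProduct.lift.tprod a).trans (by simp)

/-- The pure tensor of monomials with exponents `w`. -/
def TensorPow.monomial (m : ℕ) {ι : Type u} (w : ι → ℕ) : TensorPow m ι :=
  TensorPow.pure fun i => TruncPoly.x m ^ w i

open Classical in
theorem TensorPow.coord_monomial {m : ℕ} {ι : Type u} [Fintype ι] {W : ι → ℕ}
    (hW : ∀ i, W i < m) (w : ι → ℕ) :
    TensorPow.coord m W (TensorPow.monomial m w) = if w = W then 1 else 0 := by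
  simp only [TensorPow.monomial, TensorPow.coord_pure, TruncPoly.coeff_x_pow (hW _)]
  rw [Finset.prod_ite_zero]
  simp [funext_iff]

theorem TensorPow.monomial_eq_zero {m : ℕ} {ι : Type u} {w : ι → ℕ} {i : ι} (h : m ≤ w i) :
    TensorPow.monomial m w = 0 :=
  MultilinearMap.map_coord_zero (PiTensorProduct.tprod ℤ) i (TruncPoly.x_pow_eq_zero h)

/-- The exponents of the nonzero monomials of degree `j`. -/
abbrev Exponent (m : ℕ) (ι : Type u) [Fintype ι] (j : ℤ) : Type u :=
  {w : ι → ℕ // (∀ i, w i < m) ∧ ∑ i, (w i : ℤ) = j}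

instance (m : ℕ) (ι : Type u) [Fintype ι] (j : ℤ) : Finite (Exponent m ι j) :=
  Finite.of_injective (β := ι → Fin m) (fun w i => ⟨w.1 i, w.2.1 i⟩) fun _ _ h =>
    Subtype.ext (funext fun i => congrArg Fin.val (congrFun h i))

open Classical in
/-- The monomials form a basis of the part of degree `j`. -/
def tensorDegreeBasis (m : ℕ) (ι : Type u) [Fintype ι] (j : ℤ) :
    Module.Basis (Exponent m ι j) ℤ (tensorDegree m ι j) :=
  Module.Basis.mk (v := fun w => ⟨TensorPow.monomial m w.1,
      Submodule.subset_span ⟨w.1, w.2.2, rfl⟩⟩)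
    (by
      have := Fintype.ofFinite (Exponent m ι j)
      rw [Fintype.linearIndependent_iff]
      intro g hg w
      have h := congrArg (fun z : tensorDegree m ι j => TensorPow.coord m w.1 z.1) hg
      simp only [Submodule.coe_sum, Submodule.coe_smul, map_sum, map_smul,
        TensorPow.coord_monomial w.2.1, ZeroMemClass.coe_zero, map_zero] at h
      simpa [Subtype.ext_iff.symm] using h)
    (by
      rintro ⟨z, hz⟩ -
      have h : tensorDegree m ι j ≤ (Submodule.span ℤ (Set.range fun w : Exponent m ι j =>
          (⟨TensorPow.monomial m w.1, Submodule.subset_span ⟨w.1, w.2.2, rfl⟩⟩ :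
            tensorDegree m ι j))).map (tensorDegree m ι j).subtype := by
        refine Submodule.span_le.2 ?_
        rintro _ ⟨w, hw, rfl⟩
        -- A spanning tensor with an exponent at least `m` is zero, so it adds nothing to the span
        -- of the basis.
        by_cases hm : ∀ i, w i < m
        · exact ⟨_, Submodule.subset_span ⟨⟨w, hm, hw⟩, rfl⟩, rfl⟩
        · push Not at hm
          obtain ⟨i, hi⟩ := hm
          have : TensorPow.monomial m w = 0 := TensorPow.monomial_eq_zero hi
          change TensorPow.monomial m w ∈ _
          rw [this]
          exact Submodule.zero_mem _
      obtain ⟨y, hy, hyz⟩ := h hz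
      have : y = ⟨z, hz⟩ := Subtype.ext hyz
      exact this ▸ hy)

theorem coe_tensorDegreeBasis (m : ℕ) (ι : Type u) [Fintype ι] (j : ℤ) (w : Exponent m ι j) :
    (tensorDegreeBasis m ι j w : TensorPow m ι) = TensorPow.monomial m w.1 := by
  rw [tensorDegreeBasis, Module.Basis.mk_apply]

/-- The functionals `TensorPow.coord` live on the whole tensor power, so matrix entries can be
computed without tracking membership in the graded part. -/
theorem tensorDegreeBasis_repr (m : ℕ) (ι : Type u) [Fintype ι] (j : ℤ) (z : tensorDegree m ι j)
    (w : Exponent m ι j) : (tensorDegreeBasis m ι j).repr z w = TensorPow.coord m w.1 z := by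
  classical
  have : (tensorDegreeBasis m ι j).coord w =
      (TensorPow.coord m w.1).comp (tensorDegree m ι j).subtype := by
    refine (tensorDegreeBasis m ι j).ext fun w' => ?_
    rw [LinearMap.comp_apply, Submodule.subtype_apply, coe_tensorDegreeBasis,
      TensorPow.coord_monomial w.2.1, Module.Basis.coord_apply, Module.Basis.repr_self,
      Finsupp.single_apply]
    simp only [Subtype.ext_iff]
  exact LinearMap.congr_fun this z

variable {V : Type u} [Fintype V] (G : SimpleGraph V)

def gradedCochainEquiv (m i : ℕ) (j : ℤ) : gradedCochain G m i j ≃ₗ[ℤ]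
    ((s : {s : Finset G.edgeSet // s.card = i}) → tensorDegree m (Comp G s.1) j) where
  toFun y s := ⟨y.1 s, Submodule.mem_pi.1 y.2 s (Set.mem_univ _)⟩
  invFun z := ⟨fun s => z s, Submodule.mem_pi.2 fun s _ => (z s).2⟩
  map_add' _ _ := rfl
  map_smul' _ _ := rfl
  left_inv _ := rfl
  right_inv _ := rfl

instance (i : ℕ) : Fintype {s : Finset G.edgeSet // s.card = i} :=
  haveI : Finite (Finset G.edgeSet) := inferInstance
  Fintype.ofFinite _

def gradedCochainBasis (m i : ℕ) (j : ℤ) : Module.Basis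
    (Σ s : {s : Finset G.edgeSet // s.card = i}, Exponent m (Comp G s.1) j) ℤ
    (gradedCochain G m i j) :=
  (Pi.basis fun s : {s : Finset G.edgeSet // s.card = i} =>
    tensorDegreeBasis m (Comp G s.1) j).map (gradedCochainEquiv G m i j).symm

theorem gradedCochainBasis_repr (m i : ℕ) (j : ℤ) (y : gradedCochain G m i j)
    (k : Σ s : {s : Finset G.edgeSet // s.card = i}, Exponent m (Comp G s.1) j) :
    (gradedCochainBasis G m i j).repr y k = TensorPow.coord m k.2.1 (y.1 k.1) := by
  rw [gradedCochainBasis, Module.Basis.map_repr, LinearEquiv.trans_apply, Pi.basis_repr,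
    tensorDegreeBasis_repr]
  rfl

open Classical in
theorem gradedCochainBasis_apply (m i : ℕ) (j : ℤ)
    (k : Σ s : {s : Finset G.edgeSet // s.card = i}, Exponent m (Comp G s.1) j) :
    (gradedCochainBasis G m i j k).1 k.1 = TensorPow.monomial m k.2.1 := by
  rw [← coe_tensorDegreeBasis, gradedCochainBasis, Module.Basis.map_apply, Pi.basis_apply]
  change ((Pi.single (M := fun s : {s : Finset G.edgeSet // s.card = i} =>
    tensorDegree m (Comp G s.1) j) k.1 _) k.1).1 = _
  rw [Pi.single_eq_same]

/-! ### Components of spanning subgraphs with at most two edges -/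

section Components

variable {V : Type u} (G : SimpleGraph V)

/-- The component of a vertex in `[G : s]`. -/
def compMk (s : Finset G.edgeSet) (v : V) : Comp G s := (spanning G s).connectedComponentMk v

theorem compMk_surjective (s : Finset G.edgeSet) : Function.Surjective (compMk G s) := by
  intro κ
  induction κ using SimpleGraph.ConnectedComponent.ind with
  | h v => exact ⟨v, rfl⟩

theorem compMap_compMk {s t : Finset G.edgeSet} (h : s ⊆ t) (v : V) :
    compMap G h (compMk G s v) = compMk G t v := rfl

theorem compMk_eq_iff_of_card_zero {s : Finset G.edgeSet} (hs : s.card = 0) {a b : V} :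
    compMk G s a = compMk G s b ↔ a = b := by
  obtain rfl := Finset.card_eq_zero.1 hs
  refine ⟨fun h => ?_, fun h => h ▸ rfl⟩
  obtain ⟨p⟩ := SimpleGraph.ConnectedComponent.eq.1 h
  cases p with
  | nil => rfl
  | cons h p => simp [spanning] at h

theorem compMk_eq_of_mem {s : Finset G.edgeSet} {e : G.edgeSet} (he : e ∈ s) {a b : V}
    (hab : e.1 = s(a, b)) : compMk G s a = compMk G s b := by
  by_cases h : a = b
  · rw [h]
  refine SimpleGraph.ConnectedComponent.eq.2 (SimpleGraph.Adj.reachable ?_)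
  rw [spanning, SimpleGraph.fromEdgeSet_adj]
  exact ⟨⟨e, he, hab⟩, h⟩

/-- Every step of a walk runs along the only edge `e`, so by induction a walk ends where it started
or at the other endpoint. -/
theorem compMk_singleton_eq_iff {e : G.edgeSet} {a b : V} :
    compMk G {e} a = compMk G {e} b ↔ a = b ∨ e.1 = s(a, b) := by
  constructor
  · intro h
    obtain ⟨p⟩ := SimpleGraph.ConnectedComponent.eq.1 h
    clear h
    induction p with
    | nil => exact Or.inl rfl
    | @cons u v w h p ih =>
      have h' : e.1 = s(u, v) := by
        simpa [eq_comm] using ((SimpleGraph.fromEdgeSet_adj _).1 h).1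
      rcases ih with rfl | ih
      · exact Or.inr h'
      · rw [h', Sym2.eq_iff] at ih
        rcases ih with ⟨h1, h2⟩ | ⟨h1, -⟩
        · rw [h', h2]
          exact Or.inr rfl
        · exact Or.inl h1
  · rintro (rfl | h)
    · rfl
    · exact compMk_eq_of_mem G (Finset.mem_singleton_self e) h

variable [Fintype V]

/-- After one endpoint of the edge is dropped, each component has exactly one representative. -/
theorem card_comp_singleton (e : G.edgeSet) :
    Fintype.card (Comp G {e}) + 1 = Fintype.card V := by
  classical
  obtain ⟨e, he⟩ := e
  induction e with
  | h a b =>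
  have hab : a ≠ b := G.ne_of_adj he
  have h : Function.Bijective
      (fun v : {v // v ≠ a} => compMk G {(⟨s(a, b), he⟩ : G.edgeSet)} v.1) := by
    constructor
    · rintro ⟨v, hv⟩ ⟨w, hw⟩ h
      rcases (compMk_singleton_eq_iff G).1 h with h | h
      · exact Subtype.ext h
      · rcases Sym2.eq_iff.1 h with ⟨h1, -⟩ | ⟨h1, -⟩
        · exact absurd h1.symm hv
        · exact absurd h1.symm hw
    · intro κ
      obtain ⟨v, rfl⟩ := compMk_surjective G _ κ
      by_cases hv : v = a
      · exact ⟨⟨b, hab.symm⟩, (compMk_singleton_eq_iff G).2 (Or.inr (hv ▸ Sym2.eq_swap))⟩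
      · exact ⟨⟨v, hv⟩, rfl⟩
  rw [← Fintype.card_of_bijective h, Fintype.card_subtype_compl, Fintype.card_subtype_eq]
  have : 0 < Fintype.card V := Fintype.card_pos_iff.2 ⟨a⟩
  omega

theorem card_comp_add_two_le {s : Finset G.edgeSet} (hs : s.card = 2) :
    Fintype.card (Comp G s) + 2 ≤ Fintype.card V := by
  classical
  obtain ⟨e, f, hef, rfl⟩ := Finset.card_eq_two.1 hs
  -- Distinct edges of a simple graph do not have the same endpoints, so `e` has an endpoint `a`
  -- outside `f`. The vertices `a` and `c` can then be dropped without losing a component.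
  have key : ∃ a b c d : V, e.1 = s(a, b) ∧ f.1 = s(c, d) ∧ a ≠ c ∧ a ≠ d ∧ a ≠ b ∧ c ≠ d := by
    obtain ⟨e, he⟩ := e
    obtain ⟨f, hf⟩ := f
    induction e with
    | h a b =>
    induction f with
    | h c d =>
    have hab : a ≠ b := G.ne_of_adj he
    have hcd : c ≠ d := G.ne_of_adj hf
    have hne : s(a, b) ≠ s(c, d) := fun h => hef (Subtype.ext h)
    by_cases h1 : a = c
    · subst h1
      refine ⟨b, a, a, d, Sym2.eq_swap, rfl, hab.symm, ?_, hab.symm, hcd⟩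
      rintro rfl
      exact hne rfl
    · by_cases h2 : a = d
      · subst h2
        refine ⟨b, a, a, c, Sym2.eq_swap, Sym2.eq_swap, hab.symm, ?_, hab.symm, hcd.symm⟩
        rintro rfl
        exact hne Sym2.eq_swap
      · exact ⟨a, b, c, d, rfl, rfl, h1, h2, hab, hcd⟩
  obtain ⟨a, b, c, d, he, hf, hac, had, hab, hcd⟩ := key
  have ce : compMk G {e, f} a = compMk G {e, f} b := compMk_eq_of_mem G (by simp) he
  have cf : compMk G {e, f} c = compMk G {e, f} d := compMk_eq_of_mem G (by simp) hf
  have h : Function.Surjective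
      (fun v : {v // v ∉ ({a, c} : Finset V)} => compMk G {e, f} v.1) := by
    intro κ
    obtain ⟨v, rfl⟩ := compMk_surjective G _ κ
    have hd : d ∉ ({a, c} : Finset V) := by simp [had.symm, hcd.symm]
    by_cases hva : v = a
    · subst hva
      -- If the edges share `c`, the neighbour of `a` is itself dropped, and `d` represents the
      -- component.
      by_cases hbc : b = c
      · subst hbc
        exact ⟨⟨d, hd⟩, (ce.trans cf).symm⟩
      · exact ⟨⟨b, by simp [hab.symm, hbc]⟩, ce.symm⟩
    · by_cases hvc : v = c
      · subst hvc
        exact ⟨⟨d, hd⟩, cf.symm⟩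
      · exact ⟨⟨v, by simp [hva, hvc]⟩, rfl⟩
  have h1 := Fintype.card_le_of_surjective _ h
  have h2 : Fintype.card {v // v ∉ ({a, c} : Finset V)} + 2 = Fintype.card V := by
    rw [Fintype.card_subtype_compl, Fintype.card_coe, Finset.card_pair hac]
    have := Finset.card_le_univ ({a, c} : Finset V)
    rw [Finset.card_pair hac] at this
    omega
  omega

open Classical in
/-- The sums of `w` over the components of `[G : s]`. -/
def pushExp (s : Finset G.edgeSet) (w : V → ℕ) (κ : Comp G s) : ℕ :=
  ∑ v ∈ Finset.univ.filter (fun v => compMk G s v = κ), w v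

theorem sum_pushExp (s : Finset G.edgeSet) (w : V → ℕ) :
    ∑ κ, (pushExp G s w κ : ℤ) = ∑ v, (w v : ℤ) := by
  classical
  simp only [pushExp]
  push_cast
  rw [Finset.sum_fiberwise Finset.univ (compMk G s) (fun v => (w v : ℤ))]

theorem pushExp_of_card_zero {s : Finset G.edgeSet} (hs : s.card = 0) (w : V → ℕ) (v : V) :
    pushExp G s w (compMk G s v) = w v := by
  classical
  rw [pushExp, Finset.sum_eq_single v]
  · intro b hb hbv
    exact absurd ((compMk_eq_iff_of_card_zero G hs).1 (Finset.mem_filter.1 hb).2) hbv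
  · simp

theorem pushExp_singleton_of_mem {e : G.edgeSet} {a b : V} (h : e.1 = s(a, b)) (w : V → ℕ) :
    pushExp G {e} w (compMk G {e} a) = w a + w b := by
  classical
  have hab : a ≠ b := by
    have := e.2
    rw [h] at this
    exact G.ne_of_adj this
  have : Finset.univ.filter (fun v => compMk G {e} v = compMk G {e} a) = {a, b} := by
    ext v
    simp only [compMk_singleton_eq_iff, h, Sym2.eq_iff, Finset.mem_filter, Finset.mem_univ,
      true_and, Finset.mem_insert, Finset.mem_singleton]
    tauto
  rw [pushExp, this, Finset.sum_pair hab]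

theorem pushExp_singleton_of_notMem {e : G.edgeSet} {v : V} (h : v ∉ e.1) (w : V → ℕ) :
    pushExp G {e} w (compMk G {e} v) = w v := by
  classical
  have : Finset.univ.filter (fun v' => compMk G {e} v' = compMk G {e} v) = {v} := by
    ext v'
    simp only [compMk_singleton_eq_iff, Finset.mem_filter, Finset.mem_univ,
      true_and, Finset.mem_singleton]
    constructor
    · rintro (h' | h')
      · exact h'
      · rw [h'] at h
        simp at h
    · exact Or.inl
  rw [pushExp, this, Finset.sum_singleton]

/-- Summing over components of `[G : s]` and then over those of `[G : t]` is summing over components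
of `[G : t]`. Thus the differential acts on monomials through the vertex exponents alone. -/
theorem mergeMap_monomial_pushExp (m : ℕ) {s t : Finset G.edgeSet} (h : s ⊆ t) (w : V → ℕ) :
    mergeMap m (compMap G h) (TensorPow.monomial m (pushExp G s w)) =
      TensorPow.monomial m (pushExp G t w) := by
  classical
  rw [TensorPow.monomial, mergeMap_pure, TensorPow.monomial]
  congr 1
  funext κ
  rw [Finset.prod_pow_eq_pow_sum]
  congr 1
  simp only [pushExp]
  rw [← Finset.sum_fiberwise_of_maps_to (s := Finset.univ.filter (fun v => compMk G t v = κ))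
    (t := Finset.univ.filter (fun κ' => compMap G h κ' = κ)) (g := compMk G s)]
  · refine Finset.sum_congr rfl fun κ' hκ' => Finset.sum_congr ?_ fun _ _ => rfl
    ext v
    simp only [Finset.mem_filter, Finset.mem_univ, true_and] at hκ' ⊢
    constructor
    · rintro rfl
      exact ⟨hκ', rfl⟩
    · exact And.right
  · intro v hv
    simpa [compMap_compMk] using hv

end Components

/-! ### Exponent vectors of deficit one and three -/

section Exponents

variable {ι : Type u} [Fintype ι]

open Classical in
/-- The exponents `2` everywhere, except for `1` at `i`. -/
def deficitAt (i i' : ι) : ℕ := if i' = i then 1 else 2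

/-- The total deficit as a natural number; since exponents are at most 2, truncated subtraction
loses nothing. -/
theorem sum_two_sub (w : ι → ℕ) (hw : ∀ i, w i < 3) :
    ((∑ i, (2 - w i) : ℕ) : ℤ) = 2 * Fintype.card ι - ∑ i, (w i : ℤ) := by
  push_cast
  rw [← Finset.card_univ, mul_comm, ← nsmul_eq_mul, ← Finset.sum_const, ← Finset.sum_sub_distrib]
  refine Finset.sum_congr rfl fun i _ => ?_
  have := hw i
  omega

theorem deficitAt_mem {j : ℤ} (hj : j = 2 * (Fintype.card ι : ℤ) - 1) (i : ι) :
    (∀ i', deficitAt i i' < 3) ∧ ∑ i', (deficitAt i i' : ℤ) = j := by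
  classical
  have h : ∀ i', deficitAt i i' < 3 := fun i' => by
    rw [deficitAt]; split_ifs <;> omega
  refine ⟨h, ?_⟩
  have h2 := sum_two_sub _ h
  have h3 : ∑ i', (2 - deficitAt i i') = 1 := by
    rw [Finset.sum_eq_single i]
    · simp [deficitAt]
    · intro b _ hb
      simp [deficitAt, hb]
    · simp
  rw [h3] at h2
  push_cast at h2
  omega

/-- A total deficit of one is concentrated at a single index. -/
theorem deficitAt_bijective {j : ℤ} (hj : j = 2 * (Fintype.card ι : ℤ) - 1) :
    Function.Bijective (fun i : ι => (⟨deficitAt i, deficitAt_mem hj i⟩ : Exponent 3 ι j)) := by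
  classical
  constructor
  · intro i i' h
    have h1 := congrFun (congrArg Subtype.val h) i
    by_contra hne
    simp [deficitAt, hne] at h1
  · rintro ⟨w, hw, hs⟩
    have h1 := sum_two_sub w hw
    have h2 : ∑ i, (2 - w i) = 1 := by omega
    obtain ⟨i, -, hi⟩ : ∃ i ∈ Finset.univ, 2 - w i ≠ 0 :=
      Finset.exists_ne_zero_of_sum_ne_zero (by rw [h2]; exact one_ne_zero)
    rw [← Finset.add_sum_erase _ _ (Finset.mem_univ i)] at h2
    have h3 : ∑ i' ∈ Finset.univ.erase i, (2 - w i') = 0 := by omega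
    rw [Finset.sum_eq_zero_iff] at h3
    refine ⟨i, Subtype.ext (funext fun i' => ?_)⟩
    simp only [deficitAt]
    split_ifs with h
    · subst h; omega
    · have := h3 i' (by simp [h])
      have := hw i'
      omega

/-- The exponents of degree `2 |V| - 3`: the complementary exponents are `1` on a triple, or `2`
and `1` on an ordered pair. -/
abbrev TriplePair (V : Type u) : Type u :=
  {T : Finset V // T.card = 3} ⊕ {p : V × V // p.1 ≠ p.2}

variable {V : Type u}

open Classical in
def TriplePair.exp : TriplePair V → V → ℕ
  | .inl T, v => if v ∈ T.1 then 1 else 2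
  | .inr p, v => if v = p.1.1 then 0 else if v = p.1.2 then 1 else 2

/-- The triple is recovered as the set where the exponent is 1, the ordered pair from the places of
0 and 1; only pairs have an exponent 0. -/
theorem TriplePair.exp_injective : Function.Injective (TriplePair.exp (V := V)) := by
  classical
  rintro (⟨T, hT⟩ | ⟨⟨a, b⟩, hab⟩) (⟨T', hT'⟩ | ⟨⟨a', b'⟩, hab'⟩) h
  · congr 2
    ext v
    have := congrFun h v
    simp only [exp] at this
    split_ifs at this <;> simp_all
  · have := congrFun h a'
    simp only [exp] at this
    split_ifs at this
  · have := congrFun h a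
    simp only [exp] at this
    split_ifs at this
  · have h1 := congrFun h a
    have h2 := congrFun h b
    simp only [exp] at h1 h2
    have : b ≠ a := fun h => hab h.symm
    split_ifs at h1 h2 <;> simp_all

variable [Fintype V]

theorem TriplePair.exp_mem {j : ℤ} (hj : j = 2 * (Fintype.card V : ℤ) - 3) (k : TriplePair V) :
    (∀ v, k.exp v < 3) ∧ ∑ v, (k.exp v : ℤ) = j := by
  classical
  have h : ∀ v, k.exp v < 3 := fun v => by
    rcases k with T | p <;> simp only [exp] <;> split_ifs <;> omega
  refine ⟨h, ?_⟩
  have h2 := sum_two_sub _ h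
  have h3 : ∑ v, (2 - k.exp v) = 3 := by
    rcases k with ⟨T, hT⟩ | ⟨⟨a, b⟩, hab⟩
    · rw [← Finset.sum_subset (Finset.subset_univ T)]
      · refine Eq.trans ?_ (T.card_eq_sum_ones.symm.trans hT)
        exact Finset.sum_congr rfl fun v hv => by simp [exp, hv]
      · intro v _ hv
        simp [exp, hv]
    · rw [← Finset.sum_subset (Finset.subset_univ {a, b}), Finset.sum_pair hab]
      · have : b ≠ a := fun h => hab h.symm
        simp [exp, this]
      · intro v _ hv
        simp only [Finset.mem_insert, Finset.mem_singleton, not_or] at hv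
        simp [exp, hv.1, hv.2]
  rw [h3] at h2
  push_cast at h2
  omega

/-- Deficits of at most 2 add up to three only as 2+1 or 1+1+1. An exponent 0 uses two of the three
and leaves one for a second vertex. -/
theorem TriplePair.exists_exp_eq {j : ℤ} (hj : j = 2 * (Fintype.card V : ℤ) - 3) (w : V → ℕ)
    (hw : ∀ v, w v < 3) (hs : ∑ v, (w v : ℤ) = j) : ∃ k : TriplePair V, k.exp = w := by
  classical
  have h1 := sum_two_sub w hw
  have h2 : ∑ v, (2 - w v) = 3 := by omega
  by_cases h0 : ∃ a, w a = 0
  · obtain ⟨a, ha⟩ := h0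
    rw [← Finset.add_sum_erase _ _ (Finset.mem_univ a), ha] at h2
    have h3 : ∑ v ∈ Finset.univ.erase a, (2 - w v) = 1 := by omega
    obtain ⟨b, hb, hb'⟩ : ∃ b ∈ Finset.univ.erase a, 2 - w b ≠ 0 :=
      Finset.exists_ne_zero_of_sum_ne_zero (by rw [h3]; exact one_ne_zero)
    rw [← Finset.add_sum_erase _ _ hb] at h3
    have h4 : ∑ v ∈ (Finset.univ.erase a).erase b, (2 - w v) = 0 := by omega
    rw [Finset.sum_eq_zero_iff] at h4
    refine ⟨.inr ⟨(a, b), fun h => (Finset.mem_erase.1 hb).1 h.symm⟩, funext fun v => ?_⟩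
    simp only [exp]
    split_ifs with hva hvb
    · rw [hva, ha]
    · rw [hvb]; omega
    · have := h4 v (by simp [hva, hvb])
      have := hw v
      omega
  · push Not at h0
    refine ⟨.inl ⟨Finset.univ.filter (fun v => w v = 1), ?_⟩, funext fun v => ?_⟩
    · rw [← h2, Finset.card_eq_sum_ones, Finset.sum_filter]
      refine Finset.sum_congr rfl fun v _ => ?_
      have := hw v
      have := h0 v
      split_ifs <;> omega
    · have := hw v
      have := h0 v
      simp only [exp, Finset.mem_filter, Finset.mem_univ, true_and]
      split_ifs <;> omega

end Exponents

/-! ### Bases of the cochain groups in degree 2v-3 and the matrix of the differential -/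

section Bases

variable {V : Type u} [Fintype V] (G : SimpleGraph V) {j : ℤ}

theorem pushExp_mem {s : Finset G.edgeSet} (hs : s.card = 0) {w : V → ℕ}
    (hw : (∀ v, w v < 3) ∧ ∑ v, (w v : ℤ) = j) :
    (∀ κ, pushExp G s w κ < 3) ∧ ∑ κ, (pushExp G s w κ : ℤ) = j := by
  refine ⟨fun κ => ?_, (sum_pushExp G s w).trans hw.2⟩
  obtain ⟨v, rfl⟩ := compMk_surjective G s κ
  rw [pushExp_of_card_zero G hs]
  exact hw.1 v

def triplePairEquiv (hj : j = 2 * (Fintype.card V : ℤ) - 3) : TriplePair V ≃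
    Σ s : {s : Finset G.edgeSet // s.card = 0}, Exponent 3 (Comp G s.1) j :=
  Equiv.ofBijective (fun k => ⟨⟨∅, Finset.card_empty⟩,
    ⟨pushExp G ∅ k.exp, pushExp_mem G Finset.card_empty (k.exp_mem hj)⟩⟩) (by
    constructor
    · intro k k' h
      refine TriplePair.exp_injective (funext fun v => ?_)
      have h1 := congrFun (congrArg Subtype.val (eq_of_heq (Sigma.mk.inj h).2)) (compMk G ∅ v)
      simpa only [pushExp_of_card_zero G Finset.card_empty] using h1
    · rintro ⟨⟨s, hs⟩, w, hw⟩
      obtain rfl := Finset.card_eq_zero.1 hs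
      have hb : Function.Bijective (compMk G ∅) :=
        ⟨fun a b h => (compMk_eq_iff_of_card_zero G hs).1 h, compMk_surjective G ∅⟩
      obtain ⟨k, hk⟩ := TriplePair.exists_exp_eq hj (fun v => w (compMk G ∅ v))
        (fun v => hw.1 _) (by
          rw [← hw.2]
          exact Fintype.sum_bijective _ hb _ _ fun _ => rfl)
      have hkw : pushExp G ∅ k.exp = w := by
        funext κ
        obtain ⟨v, rfl⟩ := compMk_surjective G ∅ κ
        rw [pushExp_of_card_zero G hs, hk]
      exact ⟨k, Sigma.ext rfl (heq_of_eq (Subtype.ext hkw))⟩)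

/-- The basis of `C^{0,2v-3}`. -/
def basisZero (hj : j = 2 * (Fintype.card V : ℤ) - 3) :
    Module.Basis (TriplePair V) ℤ (gradedCochain G 3 0 j) :=
  (gradedCochainBasis G 3 0 j).reindex (triplePairEquiv G hj).symm

theorem basisZero_apply (hj : j = 2 * (Fintype.card V : ℤ) - 3) (k : TriplePair V)
    (s : {s : Finset G.edgeSet // s.card = 0}) :
    (basisZero G hj k).1 s = TensorPow.monomial 3 (pushExp G s.1 k.exp) := by
  obtain ⟨s, hs⟩ := s
  obtain rfl := Finset.card_eq_zero.1 hs
  rw [basisZero, Module.Basis.reindex_apply]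
  exact gradedCochainBasis_apply G 3 0 j (triplePairEquiv G hj k)

theorem degree_comp_singleton (hj : j = 2 * (Fintype.card V : ℤ) - 3) (e : G.edgeSet) :
    j = 2 * (Fintype.card (Comp G {e}) : ℤ) - 1 := by
  have := card_comp_singleton G e
  omega

def edgeCompEquiv (hj : j = 2 * (Fintype.card V : ℤ) - 3) : (Σ e : G.edgeSet, Comp G {e}) ≃
    Σ s : {s : Finset G.edgeSet // s.card = 1}, Exponent 3 (Comp G s.1) j :=
  Equiv.ofBijective (fun k => ⟨⟨{k.1}, Finset.card_singleton _⟩,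
    ⟨deficitAt k.2, deficitAt_mem (degree_comp_singleton G hj k.1) k.2⟩⟩) (by
    constructor
    · rintro ⟨e, κ⟩ ⟨e', κ'⟩ h
      obtain rfl : e = e' := Finset.singleton_injective
        (congrArg Subtype.val (Sigma.mk.inj h).1)
      have h1 := (deficitAt_bijective (degree_comp_singleton G hj e)).1
        (eq_of_heq (Sigma.mk.inj h).2)
      exact congrArg (Sigma.mk e) h1
    · rintro ⟨⟨s, hs⟩, w⟩
      obtain ⟨e, rfl⟩ := Finset.card_eq_one.1 hs
      obtain ⟨κ, rfl⟩ := (deficitAt_bijective (degree_comp_singleton G hj e)).2 w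
      exact ⟨⟨e, κ⟩, rfl⟩)

/-- The basis of `C^{1,2v-3}`. -/
def basisOne (hj : j = 2 * (Fintype.card V : ℤ) - 3) :
    Module.Basis (Σ e : G.edgeSet, Comp G {e}) ℤ (gradedCochain G 3 1 j) :=
  (gradedCochainBasis G 3 1 j).reindex (edgeCompEquiv G hj).symm

/-- With at most v-2 components the top degree is at most 2v-4, so no exponent vector of degree 2v-3
exists. -/
theorem gradedCochain_two_eq_bot (hj : j = 2 * (Fintype.card V : ℤ) - 3) :
    gradedCochain G 3 2 j = ⊥ := by
  rw [← Submodule.subsingleton_iff_eq_bot]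
  have : IsEmpty (Σ s : {s : Finset G.edgeSet // s.card = 2}, Exponent 3 (Comp G s.1) j) := by
    refine ⟨?_⟩
    rintro ⟨⟨s, hs⟩, w, hw, hw'⟩
    have h1 := sum_two_sub w hw
    have h2 : Fintype.card (Comp G s) + 2 ≤ Fintype.card V := card_comp_add_two_le G hs
    change _ = 2 * (Fintype.card (Comp G s) : ℤ) - _ at h1
    omega
  exact (gradedCochainBasis G 3 2 j).repr.toEquiv.subsingleton

open Classical in
/-- The matrix of the differential `C^{0,2v-3} → C^{1,2v-3}`. -/
theorem basisOne_coord_differential (ord : G.edgeSet ↪ ℕ)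
    (hj : j = 2 * (Fintype.card V : ℤ) - 3) (e : G.edgeSet) (κ : Comp G {e}) (k : TriplePair V) :
    (basisOne G hj).coord ⟨e, κ⟩ (gradedDifferential G ord 3 0 j (basisZero G hj k)) =
      if pushExp G {e} k.exp = deficitAt κ then 1 else 0 := by
  rw [Module.Basis.coord_apply, basisOne, Module.Basis.repr_reindex_apply, Equiv.symm_symm,
    gradedCochainBasis_repr]
  have h1 : ((gradedDifferential G ord 3 0 j (basisZero G hj k)).1 (edgeCompEquiv G hj ⟨e, κ⟩).1) =
      TensorPow.monomial 3 (pushExp G {e} k.exp) := by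
    change differential G ord 3 0 (basisZero G hj k).1 ⟨{e}, Finset.card_singleton e⟩ = _
    rw [differential_apply, Fintype.sum_eq_single
      (⟨e, Finset.mem_singleton_self e⟩ : {e' : G.edgeSet // e' ∈ ({e} : Finset G.edgeSet)})]
    · rw [basisZero_apply, mergeMap_monomial_pushExp]
      -- The only face of a singleton is the empty set, where no edge precedes `e`: the sign is +1,
      -- and the edge ordering plays no role.
      have : precede G ord
          (face (⟨{e}, Finset.card_singleton e⟩ : {s : Finset G.edgeSet // s.card = 0 + 1})
            ⟨e, Finset.mem_singleton_self e⟩).1 e = 0 := by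
        rw [precede, Finset.card_eq_zero.1 (face _ _).2, Finset.filter_empty, Finset.card_empty]
      rw [this, pow_zero, one_smul]
    · rintro ⟨e', he'⟩ h
      exact absurd (Subtype.ext (Finset.mem_singleton.1 he')) h
  rw [h1]
  exact TensorPow.coord_monomial
    (deficitAt_mem (degree_comp_singleton G hj e) κ).1 (pushExp G {e} k.exp)

end Bases

/-! ### The relations that present the cokernel of the dual differential -/

section Relations

variable {V : Type u} (G : SimpleGraph V)

open Classical in
theorem card_triple {a b c : V} (hab : a ≠ b) (hca : c ≠ a) (hcb : c ≠ b) :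
    ({a, b, c} : Finset V).card = 3 :=
  Finset.card_eq_three.2 ⟨a, b, c, hab, hca.symm, hcb.symm, rfl⟩

open Classical in
/-- The triple `{a, b, c}`, as an index. -/
def TriplePair.triple {a b c : V} (hab : a ≠ b) (hca : c ≠ a) (hcb : c ≠ b) : TriplePair V :=
  .inl ⟨{a, b, c}, card_triple hab hca hcb⟩

/-- The ordered pair `(a, b)`, as an index. -/
def TriplePair.pair {a b : V} (h : a ≠ b) : TriplePair V := .inr ⟨(a, b), h⟩

/-- The relations between triples and ordered pairs given by the columns of the differential. -/
def relations {M : Type*} [AddCommGroup M] (f : TriplePair V → M) : Set M :=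
  {z | ∃ (a b c : V) (h : G.Adj a b) (hca : c ≠ a) (hcb : c ≠ b),
    z = f (TriplePair.triple h.ne hca hcb) + f (TriplePair.pair hca.symm) +
      f (TriplePair.pair hcb.symm)} ∪
  {z | ∃ (a b : V) (h : G.Adj a b), z = f (TriplePair.pair h.ne) + f (TriplePair.pair h.ne.symm)}

variable [Fintype V]

theorem pushExp_eq_deficitAt_of_mem {a b : V} (h : G.Adj a b) (w : V → ℕ) :
    pushExp G {⟨s(a, b), h⟩} w = deficitAt (compMk G {⟨s(a, b), h⟩} a) ↔
      w a + w b = 1 ∧ ∀ v, v ≠ a → v ≠ b → w v = 2 := by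
  have he : (⟨s(a, b), h⟩ : G.edgeSet).1 = s(a, b) := rfl
  have hne : ∀ v, v ≠ a → v ≠ b → ¬ compMk G {⟨s(a, b), h⟩} v = compMk G {⟨s(a, b), h⟩} a := by
    intro v hva hvb
    rw [compMk_singleton_eq_iff, he, Sym2.eq_iff]
    rintro (h | ⟨h, -⟩ | ⟨-, h⟩)
    exacts [hva h, hva h.symm, hvb h.symm]
  constructor
  · intro H
    refine ⟨?_, fun v hva hvb => ?_⟩
    · rw [← pushExp_singleton_of_mem G he, H, deficitAt, if_pos rfl]
    · rw [← pushExp_singleton_of_notMem G (e := ⟨s(a, b), h⟩) (by simp [hva, hvb]) w, H, deficitAt,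
        if_neg (hne v hva hvb)]
  · rintro ⟨h1, h2⟩
    funext κ
    obtain ⟨v, rfl⟩ := compMk_surjective G _ κ
    by_cases hva : v = a
    · subst hva
      rw [pushExp_singleton_of_mem G he, h1, deficitAt, if_pos rfl]
    · by_cases hvb : v = b
      · subst hvb
        rw [← compMk_eq_of_mem G (Finset.mem_singleton_self _) he, pushExp_singleton_of_mem G he,
          h1, deficitAt, if_pos rfl]
      · rw [pushExp_singleton_of_notMem G (by simp [hva, hvb]), deficitAt,
          if_neg (hne v hva hvb), h2 v hva hvb]

theorem pushExp_eq_deficitAt_of_notMem {a b c : V} (h : G.Adj a b) (hca : c ≠ a) (hcb : c ≠ b)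
    (w : V → ℕ) :
    pushExp G {⟨s(a, b), h⟩} w = deficitAt (compMk G {⟨s(a, b), h⟩} c) ↔
      w a + w b = 2 ∧ w c = 1 ∧ ∀ v, v ≠ a → v ≠ b → v ≠ c → w v = 2 := by
  have he : (⟨s(a, b), h⟩ : G.edgeSet).1 = s(a, b) := rfl
  have hne : ∀ v, v ≠ c → ¬ compMk G {⟨s(a, b), h⟩} v = compMk G {⟨s(a, b), h⟩} c := by
    intro v hvc
    rw [compMk_singleton_eq_iff, he, Sym2.eq_iff]
    rintro (h | ⟨-, h⟩ | ⟨h, -⟩)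
    exacts [hvc h, hcb h.symm, hca h.symm]
  constructor
  · intro H
    refine ⟨?_, ?_, fun v hva hvb hvc => ?_⟩
    · rw [← pushExp_singleton_of_mem G he, H, deficitAt, if_neg (hne a hca.symm)]
    · rw [← pushExp_singleton_of_notMem G (e := ⟨s(a, b), h⟩) (by simp [hca, hcb]) w, H, deficitAt,
        if_pos rfl]
    · rw [← pushExp_singleton_of_notMem G (e := ⟨s(a, b), h⟩) (by simp [hva, hvb]) w, H, deficitAt,
        if_neg (hne v hvc)]
  · rintro ⟨h1, h2, h3⟩
    funext κ
    obtain ⟨v, rfl⟩ := compMk_surjective G _ κ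
    by_cases hva : v = a
    · subst hva
      rw [pushExp_singleton_of_mem G he, h1, deficitAt, if_neg (hne v hca.symm)]
    · by_cases hvb : v = b
      · subst hvb
        rw [← compMk_eq_of_mem G (Finset.mem_singleton_self _) he, pushExp_singleton_of_mem G he,
          h1, deficitAt, if_neg (hne a hca.symm)]
      · rw [pushExp_singleton_of_notMem G (by simp [hva, hvb])]
        by_cases hvc : v = c
        · subst hvc
          rw [h2, deficitAt, if_pos rfl]
        · rw [deficitAt, if_neg (hne v hvc), h3 v hva hvb hvc]

/-- The merged component must receive exponent 1, and 0+1 and 1+0 are the two orders of the edge. -/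
theorem exp_eq_deficitAt_of_mem {a b : V} (h : G.Adj a b) (k : TriplePair V) :
    pushExp G {⟨s(a, b), h⟩} k.exp = deficitAt (compMk G {⟨s(a, b), h⟩} a) ↔
      k = TriplePair.pair h.ne ∨ k = TriplePair.pair h.ne.symm := by
  rw [pushExp_eq_deficitAt_of_mem]
  have hab := h.ne
  have hba := h.ne.symm
  constructor
  · rintro ⟨h1, h2⟩
    have : k.exp a = 0 ∧ k.exp b = 1 ∨ k.exp a = 1 ∧ k.exp b = 0 := by omega
    rcases this with ⟨ha, hb⟩ | ⟨ha, hb⟩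
    · refine Or.inl (TriplePair.exp_injective (funext fun v => ?_))
      simp only [TriplePair.pair, TriplePair.exp]
      split_ifs with hva hvb
      exacts [hva ▸ ha, hvb ▸ hb, h2 v hva hvb]
    · refine Or.inr (TriplePair.exp_injective (funext fun v => ?_))
      simp only [TriplePair.pair, TriplePair.exp]
      split_ifs with hvb hva
      exacts [hvb ▸ hb, hva ▸ ha, h2 v hva hvb]
  · rintro (rfl | rfl)
    · simp +contextual [TriplePair.pair, TriplePair.exp, hba]
    · simp +contextual [TriplePair.pair, TriplePair.exp, hab]

/-- The deficit sits at `c`, so the merged component has exponent 2: the splitting 1+1 gives the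
triple, 0+2 and 2+0 the two pairs ending at `c`. -/
theorem exp_eq_deficitAt_of_notMem {a b c : V} (h : G.Adj a b) (hca : c ≠ a) (hcb : c ≠ b)
    (k : TriplePair V) :
    pushExp G {⟨s(a, b), h⟩} k.exp = deficitAt (compMk G {⟨s(a, b), h⟩} c) ↔
      k = TriplePair.triple h.ne hca hcb ∨ k = TriplePair.pair hca.symm ∨
        k = TriplePair.pair hcb.symm := by
  rw [pushExp_eq_deficitAt_of_notMem G h hca hcb]
  have hab := h.ne
  have hba := h.ne.symm
  constructor
  · rintro ⟨h1, h2, h3⟩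
    have : k.exp a = 1 ∧ k.exp b = 1 ∨ k.exp a = 0 ∧ k.exp b = 2 ∨ k.exp a = 2 ∧ k.exp b = 0 := by
      omega
    rcases this with ⟨ha, hb⟩ | ⟨ha, hb⟩ | ⟨ha, hb⟩
    · refine Or.inl (TriplePair.exp_injective (funext fun v => ?_))
      simp only [TriplePair.triple, TriplePair.exp]
      split_ifs with hv <;> simp only [Finset.mem_insert, Finset.mem_singleton] at hv
      · rcases hv with rfl | rfl | rfl <;> assumption
      · push Not at hv
        exact h3 v hv.1 hv.2.1 hv.2.2
    · refine Or.inr (Or.inl (TriplePair.exp_injective (funext fun v => ?_)))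
      simp only [TriplePair.pair, TriplePair.exp]
      split_ifs with hva hvc
      · exact hva ▸ ha
      · exact hvc ▸ h2
      · by_cases hvb : v = b
        exacts [hvb ▸ hb, h3 v hva hvb hvc]
    · refine Or.inr (Or.inr (TriplePair.exp_injective (funext fun v => ?_)))
      simp only [TriplePair.pair, TriplePair.exp]
      split_ifs with hvb hvc
      · exact hvb ▸ hb
      · exact hvc ▸ h2
      · by_cases hva : v = a
        exacts [hva ▸ ha, h3 v hva hvb hvc]
  · rintro (rfl | rfl | rfl)
    · simp +contextual [TriplePair.triple, TriplePair.exp]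
    · simp +contextual [TriplePair.pair, TriplePair.exp, hba, hca, hcb.symm]
    · simp +contextual [TriplePair.pair, TriplePair.exp, hab, hcb, hca.symm]

variable {j : ℤ}

theorem dualMap_coord_of_mem (ord : G.edgeSet ↪ ℕ) (hj : j = 2 * (Fintype.card V : ℤ) - 3)
    {a b : V} (h : G.Adj a b) :
    (gradedDifferential G ord 3 0 j).dualMap
        ((basisOne G hj).coord ⟨⟨s(a, b), h⟩, compMk G {⟨s(a, b), h⟩} a⟩) =
      (basisZero G hj).coord (TriplePair.pair h.ne) +
        (basisZero G hj).coord (TriplePair.pair h.ne.symm) := by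
  classical
  refine (basisZero G hj).ext fun k => ?_
  have hba := h.ne.symm
  rw [LinearMap.dualMap_apply, basisOne_coord_differential, LinearMap.add_apply]
  simp only [exp_eq_deficitAt_of_mem G h, Module.Basis.coord_apply, Module.Basis.repr_self,
    Finsupp.single_apply]
  have h12 : TriplePair.pair h.ne ≠ TriplePair.pair h.ne.symm := by
    simp [TriplePair.pair, hba]
  by_cases h1 : k = TriplePair.pair h.ne
  · subst h1
    simp [h12]
  · simp [h1]

theorem dualMap_coord_of_notMem (ord : G.edgeSet ↪ ℕ) (hj : j = 2 * (Fintype.card V : ℤ) - 3)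
    {a b c : V} (h : G.Adj a b) (hca : c ≠ a) (hcb : c ≠ b) :
    (gradedDifferential G ord 3 0 j).dualMap
        ((basisOne G hj).coord ⟨⟨s(a, b), h⟩, compMk G {⟨s(a, b), h⟩} c⟩) =
      (basisZero G hj).coord (TriplePair.triple h.ne hca hcb) +
        (basisZero G hj).coord (TriplePair.pair hca.symm) +
        (basisZero G hj).coord (TriplePair.pair hcb.symm) := by
  classical
  refine (basisZero G hj).ext fun k => ?_
  have hba := h.ne.symm
  rw [LinearMap.dualMap_apply, basisOne_coord_differential, LinearMap.add_apply,
    LinearMap.add_apply]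
  simp only [exp_eq_deficitAt_of_notMem G h hca hcb, Module.Basis.coord_apply,
    Module.Basis.repr_self, Finsupp.single_apply]
  have h12 : TriplePair.triple h.ne hca hcb ≠ TriplePair.pair hca.symm := by
    simp [TriplePair.pair, TriplePair.triple]
  have h13 : TriplePair.triple h.ne hca hcb ≠ TriplePair.pair hcb.symm := by
    simp [TriplePair.pair, TriplePair.triple]
  have h23 : TriplePair.pair hca.symm ≠ TriplePair.pair hcb.symm := by
    simp [TriplePair.pair, h.ne]
  by_cases h1 : k = TriplePair.triple h.ne hca hcb
  · subst h1
    simp [h12, h13]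
  · by_cases h2 : k = TriplePair.pair hca.symm
    · subst h2
      simp [h12.symm, h23]
    · simp [h1, h2]

/-- The image of the dual of the differential is spanned by the relations. -/
theorem range_dualMap_differential (ord : G.edgeSet ↪ ℕ)
    (hj : j = 2 * (Fintype.card V : ℤ) - 3) :
    LinearMap.range (gradedDifferential G ord 3 0 j).dualMap =
      Submodule.span ℤ (relations G (basisZero G hj).coord) := by
  classical
  apply le_antisymm
  · rw [LinearMap.range_eq_map, ← (basisOne G hj).dualBasis.span_eq, Submodule.map_span,
      Submodule.span_le]
    rintro _ ⟨_, ⟨⟨⟨e, he⟩, κ⟩, rfl⟩, rfl⟩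
    rw [Module.Basis.coe_dualBasis]
    induction e with
    | h a b =>
    have he' : G.Adj a b := he
    obtain ⟨c, rfl⟩ := compMk_surjective G _ κ
    by_cases hca : c = a
    · subst hca
      exact Submodule.subset_span (Or.inr ⟨c, b, he', dualMap_coord_of_mem G ord hj he'⟩)
    · by_cases hcb : c = b
      · subst hcb
        -- The two endpoints name the same component, so this case gives the same relation as the
        -- one before.
        rw [← compMk_eq_of_mem G (Finset.mem_singleton_self _) (rfl : s(a, c) = s(a, c))]
        exact Submodule.subset_span (Or.inr ⟨a, c, he', dualMap_coord_of_mem G ord hj he'⟩)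
      · exact Submodule.subset_span (Or.inl ⟨a, b, c, he', hca, hcb,
          dualMap_coord_of_notMem G ord hj he' hca hcb⟩)
  · rw [Submodule.span_le]
    rintro _ (⟨a, b, c, h, hca, hcb, rfl⟩ | ⟨a, b, h, rfl⟩)
    · exact ⟨_, dualMap_coord_of_notMem G ord hj h hca hcb⟩
    · exact ⟨_, dualMap_coord_of_mem G ord hj h⟩

end Relations

/-! ### Oriented edges as cellular chains, and boundaries of the 2-cells -/

section Arcs

variable {V : Type u} {G : SimpleGraph V} (c : CellChoice G)

namespace CellChoice

open Classical in
/-- The oriented edge from `a` to `b`, as a cellular chain; zero if `a` and `b` are not adjacent. -/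
def arc (a b : V) : G.edgeSet →₀ ℤ :=
  if h : G.Adj a b then
    Finsupp.single ⟨s(a, b), h⟩ (if c.edge ⟨s(a, b), h⟩ = (a, b) then 1 else -1)
  else 0

theorem arc_of_adj {a b : V} (h : G.Adj a b) :
    c.arc a b = Finsupp.single (c.step h).1 (if (c.step h).2 then (1 : ℤ) else -1) := by
  rw [arc, dif_pos h]
  congr 1
  rw [step]
  split_ifs <;> simp_all

/-- The chosen orientation of an edge agrees with exactly one of its two directions. -/
theorem arc_swap (a b : V) : c.arc b a = -c.arc a b := by
  by_cases h : G.Adj a b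
  · have he : (⟨s(b, a), h.symm⟩ : G.edgeSet) = ⟨s(a, b), h⟩ := Subtype.ext Sym2.eq_swap
    have hs := c.edge_spec ⟨s(a, b), h⟩
    have hab := h.ne
    rw [arc, arc, dif_pos h, dif_pos h.symm, he, ← Finsupp.single_neg]
    congr 1
    rcases Sym2.eq_iff.1 hs with ⟨h1, h2⟩ | ⟨h1, h2⟩
    · rw [if_neg, if_pos (Prod.ext h1 h2)]
      intro h3
      exact hab (h1.symm.trans (congrArg Prod.fst h3))
    · rw [if_pos (Prod.ext h1 h2), if_neg, neg_neg]
      intro h3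
      exact hab ((congrArg Prod.fst h3).symm.trans h1)
  · rw [arc, arc, dif_neg h, dif_neg fun h' => h h'.symm, neg_zero]

theorem edge_adj (e : G.edgeSet) : G.Adj (c.edge e).1 (c.edge e).2 := by
  have := e.2
  rw [← c.edge_spec e] at this
  exact this

theorem arc_edge (e : G.edgeSet) : c.arc (c.edge e).1 (c.edge e).2 = Finsupp.single e 1 := by
  have he : (⟨s((c.edge e).1, (c.edge e).2), c.edge_adj e⟩ : G.edgeSet) = e :=
    Subtype.ext (c.edge_spec e)
  rw [arc, dif_pos (c.edge_adj e), he, if_pos rfl]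

/-- The boundary map from 2-cells to 1-cells. -/
def boundary : (FourCycle G ⊕ Triangle G × Bool →₀ ℤ) →ₗ[ℤ] (G.edgeSet →₀ ℤ) :=
  c.cellComplex.boundary2

theorem boundary_single (f : FourCycle G ⊕ Triangle G × Bool) :
    c.boundary (Finsupp.single f 1) =
      ((c.attachPath f).map fun p => Finsupp.single p.1 (if p.2 then (1 : ℤ) else -1)).sum :=
  (Finsupp.linearCombination_single ℤ (M := c.cellComplex.Cell1 →₀ ℤ) (1 : ℤ) f).trans
    (one_smul ℤ _)

theorem boundary_square (S : FourCycle G) :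
    c.boundary (Finsupp.single (.inl S) 1) =
      c.arc (c.square S).1 (c.square S).2.1 + c.arc (c.square S).2.1 (c.square S).2.2.1 +
      c.arc (c.square S).2.2.1 (c.square S).2.2.2 + c.arc (c.square S).2.2.2 (c.square S).1 := by
  have h := (c.square_spec S).1
  rw [boundary_single, c.arc_of_adj h.1, c.arc_of_adj h.2.1, c.arc_of_adj h.2.2.1,
    c.arc_of_adj h.2.2.2.1]
  simp only [attachPath, List.map_cons, List.map_nil, List.sum_cons, List.sum_nil]
  abel

theorem boundary_triangle_true (T : Triangle G) :
    c.boundary (Finsupp.single (.inr (T, true)) 1) =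
      c.arc (c.triangle T).2.2 (c.triangle T).1 + c.arc (c.triangle T).2.2 (c.triangle T).1 -
      c.arc (c.triangle T).2.1 (c.triangle T).2.2 - c.arc (c.triangle T).1 (c.triangle T).2.1 := by
  have h := c.triangle_adj T
  rw [boundary_single, c.arc_swap (c.triangle T).2.2 (c.triangle T).2.1,
    c.arc_swap (c.triangle T).2.1 (c.triangle T).1, c.arc_of_adj h.2.2,
    c.arc_of_adj h.2.1.symm, c.arc_of_adj h.1.symm]
  simp only [attachPath, List.map_cons, List.map_nil, List.sum_cons, List.sum_nil]
  abel

theorem boundary_triangle_false (T : Triangle G) :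
    c.boundary (Finsupp.single (.inr (T, false)) 1) =
      c.arc (c.triangle T).1 (c.triangle T).2.1 + c.arc (c.triangle T).1 (c.triangle T).2.1 -
      c.arc (c.triangle T).2.2 (c.triangle T).1 - c.arc (c.triangle T).2.1 (c.triangle T).2.2 := by
  have h := c.triangle_adj T
  rw [boundary_single, c.arc_swap (c.triangle T).2.2 (c.triangle T).2.1,
    c.arc_swap (c.triangle T).1 (c.triangle T).2.2, c.arc_of_adj h.1,
    c.arc_of_adj h.2.1.symm, c.arc_of_adj h.2.2.symm]
  simp only [attachPath, List.map_cons, List.map_nil, List.sum_cons, List.sum_nil]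
  abel

end CellChoice

theorem IsSquare.rotate {p q r t : V} (h : IsSquare G (p, q, r, t)) : IsSquare G (q, r, t, p) :=
  ⟨h.2.1, h.2.2.1, h.2.2.2.1, h.1, h.2.2.2.2.2, h.2.2.2.2.1.symm⟩

theorem IsSquare.reflect {p q r t : V} (h : IsSquare G (p, q, r, t)) : IsSquare G (q, p, t, r) :=
  ⟨h.1.symm, h.2.2.2.1.symm, h.2.2.1.symm, h.2.1.symm, h.2.2.2.2.2, h.2.2.2.2.1⟩

theorem squareEdges_rotate (p q r t : V) : squareEdges (q, r, t, p) = squareEdges (p, q, r, t) := by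
  ext e
  simp only [squareEdges, Set.mem_insert_iff, Set.mem_singleton_iff]
  tauto

theorem squareEdges_reflect (p q r t : V) :
    squareEdges (q, p, t, r) = squareEdges (p, q, r, t) := by
  ext e
  simp only [squareEdges, Set.mem_insert_iff, Set.mem_singleton_iff, Sym2.eq_swap (a := q) (b := p),
    Sym2.eq_swap (a := p) (b := t), Sym2.eq_swap (a := t) (b := r), Sym2.eq_swap (a := r) (b := q)]
  tauto

/-- Two ways of running around a 4-cycle that begin with the same step agree. -/
theorem IsSquare.eq_of_squareEdges {p q r t r' t' : V} (h : IsSquare G (p, q, r, t))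
    (h' : IsSquare G (p, q, r', t')) (he : squareEdges (p, q, r, t) = squareEdges (p, q, r', t')) :
    r = r' ∧ t = t' := by
  obtain ⟨h1, h2, h3, h4, h5, h6⟩ := h
  obtain ⟨h1', h2', h3', h4', h5', h6'⟩ := h'
  dsimp only at *
  have n1 := h1.ne
  have n2 := h2.ne
  have n3 := h3.ne
  have n4 := h4.ne
  have n1' := h1'.ne
  have n2' := h2'.ne
  have n3' := h3'.ne
  have n4' := h4'.ne
  have hr : r = r' := by
    have : s(q, r) ∈ squareEdges (p, q, r', t') := he ▸ Or.inr (Or.inl rfl)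
    simp only [squareEdges, Set.mem_insert_iff, Set.mem_singleton_iff, Sym2.eq_iff] at this
    rcases this with (⟨h, -⟩ | ⟨-, h⟩) | (⟨-, h⟩ | ⟨h, -⟩) | (⟨h, -⟩ | ⟨h, -⟩) | (⟨h, -⟩ | ⟨h, -⟩)
    exacts [absurd h.symm n1, absurd h.symm h5, h, absurd h n2', absurd h n2', absurd h h6',
      absurd h h6', absurd h.symm n1]
  subst hr
  refine ⟨rfl, ?_⟩
  have : s(r, t) ∈ squareEdges (p, q, r, t') := he ▸ Or.inr (Or.inr (Or.inl rfl))
  simp only [squareEdges, Set.mem_insert_iff, Set.mem_singleton_iff, Sym2.eq_iff] at this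
  rcases this with (⟨h, -⟩ | ⟨h, -⟩) | (⟨h, -⟩ | ⟨-, h⟩) | (⟨-, h⟩ | ⟨h, -⟩) | (⟨h, -⟩ | ⟨h, -⟩)
  exacts [absurd h.symm h5, absurd h.symm n2, absurd h.symm n2, absurd h.symm h6, h, absurd h n3',
    absurd h n3', absurd h.symm h5]

/-- A function of closed paths of length four that is invariant, up to sign, under rotations and
reflections, is determined up to sign by the 4-cycle. -/
theorem IsSquare.mem_of_squareEdges {M : Type*} [AddCommGroup M] (R : Submodule ℤ M)
    (f : V → V → M) (hf : ∀ a b, f b a = -f a b) {a b a' b' p q r t : V}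
    (h : IsSquare G (p, q, r, t)) (h' : IsSquare G (a, b, a', b'))
    (he : squareEdges (p, q, r, t) = squareEdges (a, b, a', b'))
    (hR : f a b + f b a' + f a' b' + f b' a ∈ R) :
    f p q + f q r + f r t + f t p ∈ R := by
  -- Rotation permutes the four terms and reflection negates their sum; together they reach every
  -- way of running around the 4-cycle.
  have rot : ∀ {a b a' b' : V}, f a b + f b a' + f a' b' + f b' a ∈ R →
      f b a' + f a' b' + f b' a + f a b ∈ R := fun h => by
    convert h using 1
    abel
  have refl : ∀ {a b a' b' : V}, f a b + f b a' + f a' b' + f b' a ∈ R →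
      f b a + f a b' + f b' a' + f a' b ∈ R := fun {a b a' b'} h => by
    convert R.neg_mem h using 1
    rw [hf a b, hf b' a, hf a' b', hf b a']
    abel
  have fin : ∀ {a b a' b' : V}, IsSquare G (a, b, a', b') →
      squareEdges (p, q, r, t) = squareEdges (a, b, a', b') → p = a → q = b →
      f a b + f b a' + f a' b' + f b' a ∈ R → f p q + f q r + f r t + f t p ∈ R := by
    rintro a b a' b' h' he rfl rfl hR
    obtain ⟨rfl, rfl⟩ := h.eq_of_squareEdges h' he
    exact hR
  have fin2 : ∀ {a b a' b' : V}, IsSquare G (a, b, a', b') →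
      squareEdges (p, q, r, t) = squareEdges (a, b, a', b') → s(p, q) = s(a, b) →
      f a b + f b a' + f a' b' + f b' a ∈ R → f p q + f q r + f r t + f t p ∈ R := by
    intro a b a' b' h' he hpq hR
    rcases Sym2.eq_iff.1 hpq with ⟨h1, h2⟩ | ⟨h1, h2⟩
    · exact fin h' he h1 h2 hR
    · exact fin h'.reflect (he.trans (squareEdges_reflect _ _ _ _).symm) h1 h2 (refl hR)
  -- The first step of one traversal is some step of the other; up to three rotations bring it to
  -- the front, and a reflection corrects its direction.
  have hmem : s(p, q) ∈ squareEdges (a, b, a', b') := he ▸ Or.inl rfl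
  have e1 := he.trans (squareEdges_rotate a b a' b').symm
  have e2 := e1.trans (squareEdges_rotate b a' b' a).symm
  have e3 := e2.trans (squareEdges_rotate a' b' a b).symm
  rcases hmem with h1 | h1 | h1 | h1
  · exact fin2 h' he h1 hR
  · exact fin2 h'.rotate e1 h1 (rot hR)
  · exact fin2 h'.rotate.rotate e2 h1 (rot (rot hR))
  · exact fin2 h'.rotate.rotate.rotate e3 h1 (rot (rot (rot hR)))

namespace CellChoice

theorem arc_square_mem {p q r t : V} (h : IsSquare G (p, q, r, t)) :
    c.arc p q + c.arc q r + c.arc r t + c.arc t p ∈ LinearMap.range c.boundary := by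
  let S : FourCycle G := ⟨squareEdges (p, q, r, t), ⟨_, h, rfl⟩⟩
  have hS := c.square_spec S
  exact IsSquare.mem_of_squareEdges _ c.arc c.arc_swap h hS.1 hS.2.symm
    ⟨_, c.boundary_square S⟩

/-- Two of the three possible cells suffice: their boundaries and that of the third add up to zero.
Reversing the orientation of the triangle only changes signs, so all six vertex orders are covered.
-/
theorem arc_triangle_mem {p q r : V} (h1 : G.Adj p q) (h2 : G.Adj q r) (h3 : G.Adj r p) :
    c.arc p q + c.arc p q - c.arc q r - c.arc r p ∈ LinearMap.range c.boundary := by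
  classical
  let T : Triangle G := ⟨{p, q, r}, SimpleGraph.is3Clique_triple_iff.2 ⟨h1, h3.symm, h2⟩⟩
  have hT : ∀ v, (v = p ∨ v = q ∨ v = r) ↔
      (v = (c.triangle T).1 ∨ v = (c.triangle T).2.1 ∨ v = (c.triangle T).2.2) := by
    intro v
    rw [← c.triangle_spec T v]
    simp [T]
  have ht := c.boundary_triangle_true T
  have hf := c.boundary_triangle_false T
  generalize c.triangle T = x at hT ht hf
  obtain ⟨x, y, z⟩ := x
  dsimp only at hT ht hf
  have m1 : c.arc z x + c.arc z x - c.arc y z - c.arc x y ∈ LinearMap.range c.boundary := ⟨_, ht⟩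
  have m2 : c.arc x y + c.arc x y - c.arc z x - c.arc y z ∈ LinearMap.range c.boundary := ⟨_, hf⟩
  have m3 : c.arc y z + c.arc y z - c.arc x y - c.arc z x ∈ LinearMap.range c.boundary := by
    convert Submodule.neg_mem _ (Submodule.add_mem _ m1 m2) using 1
    abel
  have n1 : c.arc x z + c.arc x z - c.arc z y - c.arc y x ∈ LinearMap.range c.boundary := by
    rw [c.arc_swap z x, c.arc_swap y z, c.arc_swap x y]
    convert Submodule.neg_mem _ m1 using 1
    abel
  have n2 : c.arc y x + c.arc y x - c.arc x z - c.arc z y ∈ LinearMap.range c.boundary := by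
    rw [c.arc_swap z x, c.arc_swap y z, c.arc_swap x y]
    convert Submodule.neg_mem _ m2 using 1
    abel
  have n3 : c.arc z y + c.arc z y - c.arc y x - c.arc x z ∈ LinearMap.range c.boundary := by
    rw [c.arc_swap z x, c.arc_swap y z, c.arc_swap x y]
    convert Submodule.neg_mem _ m3 using 1
    abel
  have hpq := h1.ne
  have hqr := h2.ne
  have hrp := h3.ne
  -- Of the 27 assignments the six bijective ones remain, each matching one of `m1`, `m2`, `m3`,
  -- `n1`, `n2`, `n3` up to the order of the subtracted terms.
  rcases (hT p).1 (by simp) with rfl | rfl | rfl <;>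
  rcases (hT q).1 (by simp) with rfl | rfl | rfl <;>
  rcases (hT r).1 (by simp) with rfl | rfl | rfl <;>
  first
  | exact absurd rfl hpq
  | exact absurd rfl hqr
  | exact absurd rfl hrp
  | assumption
  | (rw [sub_right_comm]; assumption)

end CellChoice

end Arcs

/-! ### From the presented group to cellular homology plus a free group -/

section Presentation

variable {V : Type u} (G : SimpleGraph V) (o : V ↪ ℕ)

/-- The ordered pairs of vertices that give a free generator: the distance is at least three, or
it is two and the pair is ordered increasingly. -/
def IsFreePair (a b : V) : Prop :=
  a ≠ b ∧ ¬ G.Adj a b ∧ ((∃ q, G.Adj q a ∧ G.Adj q b) → o a < o b)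

/-- The index set of the free summand of the degree zero homology. -/
abbrev FreeIndex : Type u :=
  {T : Finset V // T.card = 3 ∧ ∀ a ∈ T, ∀ b ∈ T, ¬ G.Adj a b} ⊕
    {p : V × V // IsFreePair G o p.1 p.2}

variable {G} (c : CellChoice G)

/-- The direct sum of `H_1(X_{Δ,4})` and the free summand. -/
abbrev SplitHomology : Type u :=
  ((G.edgeSet →₀ ℤ) ⧸ LinearMap.range c.boundary) × (FreeIndex G o →₀ ℤ)

/-- The class of an oriented edge. -/
def arcClass (a b : V) : SplitHomology o c := (Submodule.Quotient.mk (c.arc a b), 0)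

theorem arcClass_swap (a b : V) : arcClass o c b a = -arcClass o c a b := by
  rw [arcClass, arcClass, c.arc_swap, Submodule.Quotient.mk_neg]
  exact Prod.ext rfl neg_zero.symm

theorem arcClass_square {p q r t : V} (h : IsSquare G (p, q, r, t)) :
    arcClass o c p q + arcClass o c q r + arcClass o c r t + arcClass o c t p = 0 := by
  simp only [arcClass, Prod.mk_add_mk, ← Submodule.Quotient.mk_add, add_zero]
  exact Prod.ext ((Submodule.Quotient.mk_eq_zero _).2 (c.arc_square_mem h)) rfl

theorem arcClass_triangle {p q r : V} (h1 : G.Adj p q) (h2 : G.Adj q r) (h3 : G.Adj r p) :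
    arcClass o c p q + arcClass o c p q - arcClass o c q r - arcClass o c r p = 0 := by
  simp only [arcClass, Prod.mk_add_mk, Prod.mk_sub_mk, ← Submodule.Quotient.mk_add,
    ← Submodule.Quotient.mk_sub, add_zero, sub_zero]
  exact Prod.ext ((Submodule.Quotient.mk_eq_zero _).2 (c.arc_triangle_mem h1 h2 h3)) rfl

/-- The free generator of a triple or of an ordered pair. -/
def freeClass (k : FreeIndex G o) : SplitHomology o c := (0, Finsupp.single k 1)

open Classical in
/-- The image of the generator of an ordered pair. -/
def pairImage (a b : V) : SplitHomology o c :=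
  if G.Adj a b then arcClass o c a b else
  if h : IsFreePair G o a b then freeClass o c (.inr ⟨(a, b), h⟩) else
  if h : IsFreePair G o b a ∧ ∃ q, G.Adj q a ∧ G.Adj q b then
    freeClass o c (.inr ⟨(b, a), h.1⟩) + arcClass o c h.2.choose a - arcClass o c h.2.choose b
  -- Reached only on the diagonal: of two distinct nonadjacent vertices, one order is free, and the
  -- other is free too unless there is a common neighbour.
  else 0

theorem pairImage_of_adj {a b : V} (h : G.Adj a b) : pairImage o c a b = arcClass o c a b := by
  rw [pairImage, if_pos h]

theorem pairImage_of_isFreePair {a b : V} (h : IsFreePair G o a b) :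
    pairImage o c a b = freeClass o c (.inr ⟨(a, b), h⟩) := by
  rw [pairImage, if_neg h.2.1, dif_pos h]

theorem IsFreePair.not_swap {a b q : V} (h : IsFreePair G o a b) (ha : G.Adj q a)
    (hb : G.Adj q b) : ¬ IsFreePair G o b a := fun h' =>
  lt_asymm (h.2.2 ⟨q, ha, hb⟩) (h'.2.2 ⟨q, hb, ha⟩)

theorem isFreePair_or_swap {a b : V} (h : a ≠ b) (h' : ¬ G.Adj a b) :
    IsFreePair G o a b ∨ IsFreePair G o b a := by
  rcases lt_or_gt_of_ne (o.injective.ne h) with hlt | hlt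
  · exact Or.inl ⟨h, h', fun _ => hlt⟩
  · exact Or.inr ⟨h.symm, fun h2 => h' h2.symm, fun _ => hlt⟩

theorem exists_pairImage_of_swap {a b : V} (h : IsFreePair G o b a)
    (hq : ∃ q, G.Adj q a ∧ G.Adj q b) : ∃ q, G.Adj q a ∧ G.Adj q b ∧
      pairImage o c a b = pairImage o c b a + arcClass o c q a - arcClass o c q b := by
  have h1 : ¬ IsFreePair G o a b := IsFreePair.not_swap o h hq.choose_spec.2 hq.choose_spec.1
  refine ⟨hq.choose, hq.choose_spec.1, hq.choose_spec.2, ?_⟩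
  rw [pairImage_of_isFreePair o c h, pairImage, if_neg fun h' => h.2.1 h'.symm, dif_neg h1,
    dif_pos ⟨h, hq⟩]

theorem pairImage_swap {a b : V} (h : G.Adj a b) : pairImage o c b a = -pairImage o c a b := by
  rw [pairImage_of_adj o c h, pairImage_of_adj o c h.symm, arcClass_swap]

/-- The definition of `pairImage` uses one chosen midpoint, so independence of the midpoint is the
point. Adjacent `a`, `b` give the triangle relation; otherwise `p` and the chosen midpoint are equal
or span a 4-cycle with `a` and `b`. -/
theorem pairImage_path {a p b : V} (hpa : G.Adj p a) (hpb : G.Adj p b) (hab : a ≠ b) :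
    pairImage o c a b - pairImage o c b a = pairImage o c p a - pairImage o c p b := by
  rw [pairImage_of_adj o c hpa, pairImage_of_adj o c hpb]
  by_cases h : G.Adj a b
  · rw [pairImage_of_adj o c h, pairImage_of_adj o c h.symm, arcClass_swap o c a b,
      arcClass_swap o c b p, ← sub_eq_zero, ← arcClass_triangle o c h hpb.symm hpa]
    abel
  · have key : ∀ {a b : V}, G.Adj p a → G.Adj p b → a ≠ b → IsFreePair G o b a →
        pairImage o c a b - pairImage o c b a = arcClass o c p a - arcClass o c p b := by
      intro a b hpa hpb hab hf
      obtain ⟨q, hqa, hqb, hq⟩ := exists_pairImage_of_swap o c hf ⟨p, hpa, hpb⟩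
      rw [hq]
      by_cases hpq : p = q
      · subst hpq
        abel
      · have hs : IsSquare G (a, q, b, p) := ⟨hqa.symm, hqb, hpb.symm, hpa, hab, fun h => hpq h.symm⟩
        have h0 := arcClass_square o c hs
        rw [arcClass_swap o c q a, arcClass_swap o c p b, ← sub_eq_add_neg] at h0
        rw [← sub_eq_zero, ← neg_eq_zero, ← h0]
        abel
    rcases isFreePair_or_swap o hab h with hf | hf
    · have := key hpb hpa hab.symm hf
      rw [← neg_inj, neg_sub, neg_sub]
      exact this
    · exact key hpa hpb hab hf

open Classical in
/-- The image of the generator of a triple. -/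
def tripleImage (T : {T : Finset V // T.card = 3}) : SplitHomology o c :=
  if h : ∃ x : V × V × V, G.Adj x.1 x.2.1 ∧ x.2.2 ≠ x.1 ∧ x.2.2 ≠ x.2.1 ∧
      T.1 = {x.1, x.2.1, x.2.2} then
    -pairImage o c h.choose.1 h.choose.2.2 - pairImage o c h.choose.2.1 h.choose.2.2
  else if h : ∀ a ∈ T.1, ∀ b ∈ T.1, ¬ G.Adj a b then freeClass o c (.inl ⟨T.1, T.2, h⟩)
  -- Never reached: a triple with two adjacent vertices has a third vertex and falls under the first
  -- case.
  else 0

theorem tripleImage_of_free {T : Finset V} (h : T.card = 3 ∧ ∀ a ∈ T, ∀ b ∈ T, ¬ G.Adj a b) :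
    tripleImage o c ⟨T, h.1⟩ = freeClass o c (.inl ⟨T, h⟩) := by
  classical
  rw [tripleImage, dif_neg, dif_pos h.2]
  rintro ⟨⟨x, y, z⟩, h1, -, -, h2⟩
  dsimp only at h1 h2
  exact h.2 x (by simp [h2]) y (by simp [h2]) h1

open Classical in
-- The value assigned to a triple must not depend on which of its edges is used. Two distinct edges
-- of a triple form a path, and `pairImage_path` compares them.
theorem pairImage_triple {a p b a' p' b' : V} (h : G.Adj a p) (hba : b ≠ a) (hbp : b ≠ p)
    (h' : G.Adj a' p') (hba' : b' ≠ a') (hbp' : b' ≠ p')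
    (hT : ({a, p, b} : Finset V) = {a', p', b'}) :
    pairImage o c a b + pairImage o c p b = pairImage o c a' b' + pairImage o c p' b' := by
  have hap := h.ne
  have step : ∀ {x y z : V}, G.Adj x y → G.Adj y z → z ≠ x →
      pairImage o c x z + pairImage o c y z = pairImage o c y x + pairImage o c z x := by
    intro x y z hxy hyz hzx
    have := pairImage_path o c hxy.symm hyz hzx.symm
    rw [← sub_eq_zero] at this ⊢
    rw [← this]
    abel
  have m1 : ∀ v, (v = a ∨ v = p ∨ v = b) ↔ (v = a' ∨ v = p' ∨ v = b') := by
    intro v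
    have := Finset.ext_iff.1 hT v
    simpa using this
  have hap' := h'.ne
  -- Among the six orders of the triple, two use the same edge; the other four use a second edge and
  -- reduce to `step`.
  rcases (m1 a').2 (by simp) with rfl | rfl | rfl <;>
  rcases (m1 p').2 (by simp) with rfl | rfl | rfl <;>
  rcases (m1 b').2 (by simp) with rfl | rfl | rfl <;>
  first
  | exact absurd rfl hap'
  | exact absurd rfl hba'
  | exact absurd rfl hbp'
  | rfl
  | exact add_comm _ _
  | exact (step h h' hba).trans (add_comm _ _)
  | exact step h h' hba
  | exact step h h'.symm hba
  | exact (step h h'.symm hba).trans (add_comm _ _)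
  | exact ((add_comm _ _).trans (step h.symm h' hbp)).trans (add_comm _ _)
  | exact (add_comm _ _).trans (step h.symm h' hbp)
  | exact ((add_comm _ _).trans (step h.symm h'.symm hbp)).trans (add_comm _ _)

theorem tripleImage_triple {a p b : V} (h : G.Adj a p) (hba : b ≠ a) (hbp : b ≠ p) (hT) :
    tripleImage o c ⟨open Classical in {a, p, b}, hT⟩ =
      -pairImage o c a b - pairImage o c p b := by
  classical
  have hex : ∃ x : V × V × V, G.Adj x.1 x.2.1 ∧ x.2.2 ≠ x.1 ∧ x.2.2 ≠ x.2.1 ∧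
      (open Classical in {a, p, b} : Finset V) = (open Classical in {x.1, x.2.1, x.2.2}) :=
    ⟨(a, p, b), h, hba, hbp, rfl⟩
  have hs := hex.choose_spec
  rw [tripleImage, dif_pos hex, ← neg_add', ← neg_add', neg_inj]
  exact (pairImage_triple o c h hba hbp hs.1 hs.2.1 hs.2.2.1 hs.2.2.2).symm

/-- The images of the generators. -/
def generatorImage : TriplePair V → SplitHomology o c
  | .inl T => tripleImage o c T
  | .inr p => pairImage o c p.1.1 p.1.2

theorem generatorImage_relation {M : Type*} [AddCommGroup M] (β : Module.Basis (TriplePair V) ℤ M)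
    {z : M} (hz : z ∈ relations G β) : β.constr ℤ (generatorImage o c) z = 0 := by
  rcases hz with ⟨a, p, b, h, hba, hbp, rfl⟩ | ⟨a, b, h, rfl⟩
  · rw [map_add, map_add, Module.Basis.constr_basis, Module.Basis.constr_basis,
      Module.Basis.constr_basis]
    change tripleImage o c ⟨_, _⟩ + pairImage o c a b + pairImage o c p b = 0
    rw [tripleImage_triple o c h hba hbp]
    abel
  · rw [map_add, Module.Basis.constr_basis, Module.Basis.constr_basis]
    change pairImage o c a b + pairImage o c b a = 0
    rw [pairImage_swap o c h, add_neg_cancel]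

section Inverse

variable {M : Type*} [AddCommGroup M] (f : TriplePair V → M)

open Classical in
/-- The generator of an ordered pair, extended by zero to the diagonal. -/
def pairGen (a b : V) : M := if h : a ≠ b then f (TriplePair.pair h) else 0

theorem pairGen_of_ne {a b : V} (h : a ≠ b) : pairGen f a b = f (TriplePair.pair h) := dif_pos h

variable (hf : ∀ z ∈ relations G f, z = 0)

include hf

theorem pairGen_swap {a b : V} (h : G.Adj a b) : pairGen f b a = -pairGen f a b := by
  rw [pairGen_of_ne f h.ne, pairGen_of_ne f h.ne.symm, eq_neg_iff_add_eq_zero, add_comm]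
  exact hf _ (Or.inr ⟨a, b, h, rfl⟩)

theorem gen_triple {a p b : V} (h : G.Adj a p) (hba : b ≠ a) (hbp : b ≠ p) :
    f (TriplePair.triple h.ne hba hbp) = -pairGen f a b - pairGen f p b := by
  rw [pairGen_of_ne f hba.symm, pairGen_of_ne f hbp.symm, ← sub_eq_zero]
  rw [← hf _ (Or.inl ⟨a, p, b, h, hba, hbp, rfl⟩)]
  abel

/-- The triple `{a, p, b}` contains the edges `ap` and `pb`, so its generator can be eliminated in
two ways; the relation equates the results. -/
theorem pairGen_path {a p b : V} (hpa : G.Adj p a) (hpb : G.Adj p b) (hab : a ≠ b) :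
    pairGen f a b - pairGen f b a = pairGen f p a - pairGen f p b := by
  have h1 := gen_triple f hf hpa.symm hab.symm hpb.ne.symm
  have h2 := gen_triple f hf hpb hpa.ne.symm hab
  have h3 : TriplePair.triple hpa.symm.ne hab.symm hpb.ne.symm =
      TriplePair.triple hpb.ne hpa.ne.symm hab := by
    classical
    refine congrArg Sum.inl (Subtype.ext ?_)
    ext v
    simp only [Finset.mem_insert, Finset.mem_singleton]
    tauto
  rw [h3, h2, ← sub_eq_zero] at h1
  rw [← sub_eq_zero, ← h1]
  abel

/-- The opposite vertices `p` and `r` have the two midpoints `q` and `t`, and `pairGen_path` gives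
the same difference through either. -/
theorem pairGen_square {p q r t : V} (h : IsSquare G (p, q, r, t)) :
    pairGen f p q + pairGen f q r + pairGen f r t + pairGen f t p = 0 := by
  obtain ⟨h1, h2, h3, h4, h5, -⟩ := h
  dsimp only at *
  have e1 := pairGen_path f hf h1.symm h2 h5
  have e2 := pairGen_path f hf h4 h3.symm h5
  rw [e1, ← sub_eq_zero] at e2
  rw [pairGen_swap f hf h1.symm, pairGen_swap f hf h3.symm, ← neg_eq_zero, ← e2]
  abel

/-- The path relation for an adjacent pair, where antisymmetry turns the left side into twice one
generator. -/
theorem pairGen_triangle {p q r : V} (h1 : G.Adj p q) (h2 : G.Adj q r) (h3 : G.Adj r p) :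
    pairGen f p q + pairGen f p q - pairGen f q r - pairGen f r p = 0 := by
  have e := pairGen_path f hf h3 h2.symm h1.ne
  rw [← sub_eq_zero, pairGen_swap f hf h1, pairGen_swap f hf h2] at e
  rw [← e]
  abel

end Inverse

end Presentation

/-! ### The inverse map and the presentation isomorphism -/

section PresentationEquiv

variable {V : Type u} {G : SimpleGraph V} (o : V ↪ ℕ) (c : CellChoice G)

section

variable {M : Type*} [AddCommGroup M] (f : TriplePair V → M)

/-- The map on cellular 1-chains that sends an edge to the generator of its ordered pair. -/
def edgeLift : (G.edgeSet →₀ ℤ) →ₗ[ℤ] M :=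
  Finsupp.linearCombination ℤ fun e => pairGen f (c.edge e).1 (c.edge e).2

/-- The map on the free summand. -/
def freeLift : (FreeIndex G o →₀ ℤ) →ₗ[ℤ] M :=
  Finsupp.linearCombination ℤ fun k =>
    match k with
    | .inl T => f (.inl ⟨T.1, T.2.1⟩)
    | .inr p => pairGen f p.1.1 p.1.2

theorem edgeLift_single (e : G.edgeSet) :
    edgeLift c f (Finsupp.single e 1) = pairGen f (c.edge e).1 (c.edge e).2 := by
  rw [edgeLift, Finsupp.linearCombination_single, one_smul]

variable (hf : ∀ z ∈ relations G f, z = 0)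

include hf

theorem edgeLift_arc {a b : V} (h : G.Adj a b) : edgeLift c f (c.arc a b) = pairGen f a b := by
  have key : ∀ {a b : V} (e : G.edgeSet), (c.edge e).1 = a → (c.edge e).2 = b →
      edgeLift c f (c.arc a b) = pairGen f a b := by
    rintro _ _ e rfl rfl
    rw [c.arc_edge, edgeLift_single]
  rcases Sym2.eq_iff.1 (c.edge_spec ⟨s(a, b), h⟩) with ⟨h1, h2⟩ | ⟨h1, h2⟩
  · exact key _ h1 h2
  · rw [c.arc_swap b a, map_neg, key _ h1 h2, pairGen_swap f hf h, neg_neg]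

/-- Each attached cell imposes a relation that already holds among the pair generators, so the map
on 1-chains descends to homology. -/
theorem edgeLift_comp_boundary : (edgeLift c f).comp c.boundary = 0 := by
  refine Finsupp.lhom_ext' fun k => LinearMap.ext_ring ?_
  rw [LinearMap.comp_apply, LinearMap.comp_apply, Finsupp.lsingle_apply, LinearMap.zero_comp,
    LinearMap.zero_apply]
  rcases k with S | ⟨T, _ | _⟩
  · have h := (c.square_spec S).1
    rw [c.boundary_square, map_add, map_add, map_add, edgeLift_arc c f hf h.1,
      edgeLift_arc c f hf h.2.1, edgeLift_arc c f hf h.2.2.1, edgeLift_arc c f hf h.2.2.2.1]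
    exact pairGen_square f hf h
  · have h := c.triangle_adj T
    rw [c.boundary_triangle_false, map_sub, map_sub, map_add, edgeLift_arc c f hf h.1,
      edgeLift_arc c f hf h.2.1, edgeLift_arc c f hf h.2.2, sub_right_comm]
    exact pairGen_triangle f hf h.1 h.2.1 h.2.2
  · have h := c.triangle_adj T
    rw [c.boundary_triangle_true, map_sub, map_sub, map_add, edgeLift_arc c f hf h.1,
      edgeLift_arc c f hf h.2.1, edgeLift_arc c f hf h.2.2, sub_right_comm]
    exact pairGen_triangle f hf h.2.2 h.1 h.2.1

/-- The inverse of the map defined by `generatorImage`. -/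
def splitLift : SplitHomology o c →ₗ[ℤ] M :=
  LinearMap.coprod
    ((LinearMap.range c.boundary).liftQ (edgeLift c f)
      (LinearMap.range_le_ker_iff.2 (edgeLift_comp_boundary c f hf)))
    (freeLift o f)

theorem splitLift_arcClass {a b : V} (h : G.Adj a b) :
    splitLift o c f hf (arcClass o c a b) = pairGen f a b := by
  rw [splitLift, arcClass, LinearMap.coprod_apply, map_zero, add_zero, Submodule.liftQ_apply,
    edgeLift_arc c f hf h]

theorem splitLift_freeClass (k : FreeIndex G o) :
    splitLift o c f hf (freeClass o c k) = freeLift o f (Finsupp.single k 1) := by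
  rw [splitLift, freeClass, LinearMap.coprod_apply, map_zero, zero_add]

/-- Edges and free pairs are sent back directly. A non-free order has a common neighbour, and
`pairGen_path` recovers it from the free order. -/
theorem splitLift_pairImage {a b : V} (hab : a ≠ b) :
    splitLift o c f hf (pairImage o c a b) = pairGen f a b := by
  have hfree : ∀ {a b : V}, IsFreePair G o a b →
      splitLift o c f hf (pairImage o c a b) = pairGen f a b := by
    intro a b h
    rw [pairImage_of_isFreePair o c h, splitLift_freeClass, freeLift,
      Finsupp.linearCombination_single, one_smul]
  by_cases h : G.Adj a b
  · rw [pairImage_of_adj o c h, splitLift_arcClass o c f hf h]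
  by_cases h1 : IsFreePair G o a b
  · exact hfree h1
  · have h2 : IsFreePair G o b a := (isFreePair_or_swap o hab h).resolve_left h1
    have hq : ∃ q, G.Adj q a ∧ G.Adj q b := by
      by_contra hq
      exact h1 ⟨hab, h, fun hq' => absurd hq' hq⟩
    obtain ⟨q, hqa, hqb, e⟩ := exists_pairImage_of_swap o c h2 hq
    rw [e, map_sub, map_add, hfree h2, splitLift_arcClass o c f hf hqa,
      splitLift_arcClass o c f hf hqb, add_sub_assoc, ← pairGen_path f hf hqa hqb hab]
    abel

theorem splitLift_generatorImage (k : TriplePair V) :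
    splitLift o c f hf (generatorImage o c k) = f k := by
  classical
  rcases k with ⟨T, hT⟩ | ⟨⟨a, b⟩, hab⟩
  · by_cases h : ∀ a ∈ T, ∀ b ∈ T, ¬ G.Adj a b
    · change splitLift o c f hf (tripleImage o c ⟨T, hT⟩) = _
      rw [tripleImage_of_free o c ⟨hT, h⟩, splitLift_freeClass, freeLift,
        Finsupp.linearCombination_single, one_smul]
    · push Not at h
      obtain ⟨a, ha, p, hp, hap⟩ := h
      -- The third vertex of the triple, needed to express its generator through the edge `ap`.
      obtain ⟨b, hb⟩ : ((T.erase a).erase p).Nonempty := by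
        rw [← Finset.card_pos, Finset.card_erase_of_mem (by simp [hp, hap.ne.symm]),
          Finset.card_erase_of_mem ha, hT]
        norm_num
      simp only [Finset.mem_erase] at hb
      have hT' : T = {a, p, b} := by
        refine (Finset.eq_of_subset_of_card_le (fun v hv => ?_) ?_).symm
        · simp only [Finset.mem_insert, Finset.mem_singleton] at hv
          rcases hv with rfl | rfl | rfl
          exacts [ha, hp, hb.2.2]
        · rw [hT, card_triple hap.ne hb.2.1 hb.1]
      subst hT'
      have e := gen_triple f hf hap hb.2.1 hb.1
      change splitLift o c f hf (tripleImage o c ⟨_, hT⟩) = _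
      rw [tripleImage_triple o c hap hb.2.1 hb.1, map_sub, map_neg,
        splitLift_pairImage o c f hf (Ne.symm hb.2.1), splitLift_pairImage o c f hf (Ne.symm hb.1)]
      exact e.symm
  · exact (splitLift_pairImage o c f hf hab).trans (pairGen_of_ne f hab)

end

/-- The group presented by the relations is `H_1(X_{Δ,4})` plus a free summand. -/
theorem nonempty_presentation_equiv {M : Type*} [AddCommGroup M]
    (β : Module.Basis (TriplePair V) ℤ M) :
    Nonempty ((M ⧸ Submodule.span ℤ (relations G β)) ≃ₗ[ℤ] SplitHomology o c) := by
  let R := Submodule.span ℤ (relations G β)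
  let f : TriplePair V → M ⧸ R := fun k => R.mkQ (β k)
  have hf : ∀ z ∈ relations G f, z = 0 := by
    rintro _ (⟨a, p, b, h, hba, hbp, rfl⟩ | ⟨a, b, h, rfl⟩)
    · simp only [f, ← map_add]
      exact (Submodule.Quotient.mk_eq_zero _).2
        (Submodule.subset_span (Or.inl ⟨a, p, b, h, hba, hbp, rfl⟩))
    · simp only [f, ← map_add]
      exact (Submodule.Quotient.mk_eq_zero _).2 (Submodule.subset_span (Or.inr ⟨a, b, h, rfl⟩))
  let Φ : M ⧸ R →ₗ[ℤ] SplitHomology o c := R.liftQ (β.constr ℤ (generatorImage o c))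
    (Submodule.span_le.2 fun z hz => generatorImage_relation o c β hz)
  have hΦ : ∀ k, Φ (f k) = generatorImage o c k := fun k =>
    (Submodule.liftQ_apply _ _ _).trans (β.constr_basis ℤ _ _)
  have hΦ' : ∀ {a b : V}, a ≠ b → Φ (pairGen f a b) = pairImage o c a b := by
    intro a b hab
    rw [pairGen_of_ne f hab, hΦ]
    rfl
  refine ⟨LinearEquiv.ofLinearMap Φ (splitLift o c f hf) ?_ ?_⟩
  · refine LinearMap.prod_ext ?_ ?_
    -- On the homology summand it is enough to test an edge in its chosen orientation, where its
    -- class is an `arcClass`.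
    · refine Submodule.linearMap_qext _ (Finsupp.lhom_ext' fun e => LinearMap.ext_ring ?_)
      change Φ (splitLift o c f hf (Submodule.Quotient.mk (Finsupp.single e 1), 0)) =
        (Submodule.Quotient.mk (Finsupp.single e 1), 0)
      have h := c.edge_adj e
      rw [← c.arc_edge e]
      refine (congrArg Φ (splitLift_arcClass o c f hf h)).trans ?_
      rw [hΦ' h.ne, pairImage_of_adj o c h]
      rfl
    · refine Finsupp.lhom_ext' fun k => LinearMap.ext_ring ?_
      change Φ (splitLift o c f hf (freeClass o c k)) = freeClass o c k
      rw [splitLift_freeClass, freeLift, Finsupp.linearCombination_single, one_smul]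
      rcases k with ⟨T, hT⟩ | ⟨p, hp⟩
      · exact (hΦ _).trans (tripleImage_of_free o c hT)
      · exact (hΦ' hp.1).trans (pairImage_of_isFreePair o c hp)
  · refine Submodule.linearMap_qext _ (β.ext fun k => ?_)
    exact (congrArg _ (hΦ k)).trans (splitLift_generatorImage o c f hf k)

end PresentationEquiv

/-! ### Counting triples, pairs and cells -/

section Counting

variable {V : Type u} (G : SimpleGraph V)

/-- The edges of `G` inside a set of vertices. -/
def edgesWithin (T : Finset V) : Set (Sym2 V) := {e ∈ G.edgeSet | ∀ v ∈ e, v ∈ T}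

theorem mk_mem_edgesWithin {T : Finset V} {a b : V} :
    s(a, b) ∈ edgesWithin G T ↔ G.Adj a b ∧ a ∈ T ∧ b ∈ T := by
  simp [edgesWithin]

open Classical in
theorem edgesWithin_subset (T : Finset V) :
    edgesWithin G T ⊆ (T.offDiag.image (fun p : V × V => s(p.1, p.2)) : Finset (Sym2 V)) := by
  intro e he
  induction e with
  | h a b =>
  rw [mk_mem_edgesWithin] at he
  rw [Finset.coe_image]
  exact ⟨(a, b), by simp [he.2.1, he.2.2, he.1.ne], rfl⟩

open Classical in
theorem card_pairs_of_card_three {T : Finset V} (hT : T.card = 3) :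
    (T.offDiag.image (fun p : V × V => s(p.1, p.2))).card = 3 := by
  have := Sym2.card_image_offDiag T
  rw [hT] at this
  exact this

theorem edgesWithin_finite (T : Finset V) : (edgesWithin G T).Finite := by
  classical
  exact (Finset.finite_toSet _).subset (edgesWithin_subset G T)

theorem ncard_edgesWithin_le {T : Finset V} (hT : T.card = 3) : (edgesWithin G T).ncard ≤ 3 := by
  classical
  have := Set.ncard_le_ncard (edgesWithin_subset G T) (Finset.finite_toSet _)
  rwa [Set.ncard_coe_finset, card_pairs_of_card_three hT] at this

theorem ncard_edgesWithin_eq_three_iff {T : Finset V} (hT : T.card = 3) :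
    (edgesWithin G T).ncard = 3 ↔ G.IsNClique 3 T := by
  classical
  rw [SimpleGraph.isNClique_iff, and_iff_left hT, SimpleGraph.isClique_iff]
  constructor
  · intro h a ha b hb hab
    have h1 := Set.eq_of_subset_of_ncard_le (edgesWithin_subset G T)
      (by rw [Set.ncard_coe_finset, card_pairs_of_card_three hT, h]) (Finset.finite_toSet _)
    have h2 : s(a, b) ∈ edgesWithin G T := by
      rw [h1, Finset.coe_image]
      exact ⟨(a, b), by simpa using ⟨ha, hb, hab⟩, rfl⟩
    exact ((mk_mem_edgesWithin G).1 h2).1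
  · intro h
    have h1 : edgesWithin G T =
        (T.offDiag.image (fun p : V × V => s(p.1, p.2)) : Finset (Sym2 V)) := by
      refine (edgesWithin_subset G T).antisymm ?_
      intro e he
      rw [Finset.coe_image] at he
      obtain ⟨⟨a, b⟩, hab, rfl⟩ := he
      simp only [Finset.coe_offDiag, Set.mem_offDiag, Finset.mem_coe] at hab
      exact (mk_mem_edgesWithin G).2 ⟨h hab.1 hab.2.1 hab.2.2, hab.1, hab.2.1⟩
    rw [h1, Set.ncard_coe_finset, card_pairs_of_card_three hT]

theorem ncard_edgesWithin_eq_zero_iff {T : Finset V} :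
    (edgesWithin G T).ncard = 0 ↔ ∀ a ∈ T, ∀ b ∈ T, ¬ G.Adj a b := by
  rw [Set.ncard_eq_zero (edgesWithin_finite G T), Set.eq_empty_iff_forall_notMem]
  constructor
  · intro h a ha b hb hab
    exact h s(a, b) ((mk_mem_edgesWithin G).2 ⟨hab, ha, hb⟩)
  · intro h e he
    induction e with
    | h a b =>
    rw [mk_mem_edgesWithin] at he
    exact h a he.2.1 b he.2.2 he.1

theorem edist_eq_two_iff_exists {a b : V} :
    G.edist a b = 2 ↔ a ≠ b ∧ ¬ G.Adj a b ∧ ∃ q, G.Adj q a ∧ G.Adj q b := by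
  rw [SimpleGraph.edist_eq_two_iff]
  simp only [Set.Nonempty, SimpleGraph.mem_commonNeighbors, SimpleGraph.adj_comm]

theorem three_le_edist_iff {a b : V} :
    3 ≤ G.edist a b ↔ a ≠ b ∧ ¬ G.Adj a b ∧ ¬ ∃ q, G.Adj q a ∧ G.Adj q b := by
  have h : (3 : ℕ∞) ≤ G.edist a b ↔ 2 < G.edist a b := by
    rw [← ENat.add_one_le_iff (by simp)]
    norm_num
  rw [h, SimpleGraph.two_lt_edist_iff, ← Set.not_nonempty_iff_eq_empty]
  simp only [Set.Nonempty, SimpleGraph.mem_commonNeighbors, SimpleGraph.adj_comm]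

variable [Fintype V]

open Classical in
theorem tripleCount_eq_card (k : ℕ) : tripleCount G k =
    ((Finset.univ.powersetCard 3).filter fun T => (edgesWithin G T).ncard = k).card := by
  rw [tripleCount, ← Set.ncard_coe_finset]
  congr 1
  ext T
  rw [Finset.mem_coe, Finset.mem_filter, Finset.mem_powersetCard_univ]
  rfl

theorem tripleCount_sum : tripleCount G 0 + tripleCount G 1 + tripleCount G 2 + tripleCount G 3 =
    Nat.card {T : Finset V // T.card = 3} := by
  classical
  have h := Finset.card_eq_sum_card_fiberwise (s := (Finset.univ : Finset V).powersetCard 3)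
    (t := Finset.range 4) (f := fun T => (edgesWithin G T).ncard) (fun T hT => by
      have := ncard_edgesWithin_le G (Finset.mem_powersetCard.1 hT).2
      simp only [Finset.coe_range, Set.mem_Iio]
      omega)
  simp only [Finset.sum_range_succ, Finset.sum_range_zero, zero_add, ← tripleCount_eq_card] at h
  rw [← h, Nat.card_eq_fintype_card, Fintype.card_subtype]
  congr 1
  ext T
  simp [Finset.mem_powersetCard]

open Classical in
theorem card_filter_triples {a b : V} (hab : a ≠ b) :
    (((Finset.univ : Finset V).powersetCard 3).filter fun T => a ∈ T ∧ b ∈ T).card + 2 =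
      Fintype.card V := by
  have h : ((Finset.univ : Finset V).powersetCard 3).filter (fun T => a ∈ T ∧ b ∈ T) =
      (Finset.univ \ {a, b}).image (fun x => {a, b, x}) := by
    ext T
    simp only [Finset.mem_filter, Finset.mem_powersetCard_univ, Finset.mem_image,
      Finset.mem_sdiff, Finset.mem_univ, true_and, Finset.mem_insert, Finset.mem_singleton, not_or]
    constructor
    · rintro ⟨hT, ha, hb⟩
      obtain ⟨x, hx⟩ : ((T.erase a).erase b).Nonempty := by
        rw [← Finset.card_pos, Finset.card_erase_of_mem (by simp [hb, hab.symm]),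
          Finset.card_erase_of_mem ha, hT]
        norm_num
      simp only [Finset.mem_erase] at hx
      refine ⟨x, ⟨hx.2.1, hx.1⟩, Finset.eq_of_subset_of_card_le (fun v hv => ?_) ?_⟩
      · simp only [Finset.mem_insert, Finset.mem_singleton] at hv
        rcases hv with rfl | rfl | rfl
        exacts [ha, hb, hx.2.2]
      · rw [hT, card_triple hab hx.2.1 hx.1]
    · rintro ⟨x, hx, rfl⟩
      exact ⟨card_triple hab hx.1 hx.2, by simp, by simp⟩
  rw [h, Finset.card_image_of_injOn]
  · rw [← Finset.card_univ, ← Finset.card_sdiff_add_card_eq_card (Finset.subset_univ {a, b}),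
      Finset.card_pair hab]
  · intro x hx y _ hxy
    have : x ∈ ({a, b, y} : Finset V) := by
      rw [← show ({a, b, x} : Finset V) = {a, b, y} from hxy]
      simp
    simp at hx this
    tauto

/-- Double counting of edges inside triples: each edge lies in v-2 triples, one for each choice of
the third vertex. -/
theorem sum_tripleCount : (tripleCount G 1 + 2 * tripleCount G 2 + 3 * tripleCount G 3 : ℕ) +
    2 * Nat.card G.edgeSet = Nat.card G.edgeSet * Fintype.card V := by
  classical
  have h1 : ∑ T ∈ (Finset.univ : Finset V).powersetCard 3, (edgesWithin G T).ncard =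
      tripleCount G 1 + 2 * tripleCount G 2 + 3 * tripleCount G 3 := by
    rw [← Finset.sum_fiberwise_of_maps_to (t := Finset.range 4)
      (g := fun T => (edgesWithin G T).ncard) (fun T hT => by
        have := ncard_edgesWithin_le G (Finset.mem_powersetCard.1 hT).2
        rw [Finset.mem_range]
        omega)]
    have h : ∀ k, ∑ T ∈ ((Finset.univ : Finset V).powersetCard 3).filter
        (fun T => (edgesWithin G T).ncard = k), (edgesWithin G T).ncard = k * tripleCount G k := by
      intro k
      rw [Finset.sum_congr rfl (fun T hT => (Finset.mem_filter.1 hT).2), Finset.sum_const,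
        smul_eq_mul, tripleCount_eq_card, mul_comm]
    simp only [h, Finset.sum_range_succ, Finset.sum_range_zero]
    ring
  have h2 : ∀ T : Finset V, (edgesWithin G T).ncard =
      ∑ e ∈ G.edgeFinset, if ∀ v ∈ e, v ∈ T then 1 else 0 := by
    intro T
    rw [← Finset.card_filter, ← Set.ncard_coe_finset]
    congr 1
    ext e
    simp [edgesWithin]
  have h3 : ∀ e ∈ G.edgeFinset, (∑ T ∈ (Finset.univ : Finset V).powersetCard 3,
      if ∀ v ∈ e, v ∈ T then 1 else 0) + 2 = Fintype.card V := by
    intro e he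
    induction e with
    | h a b =>
    have hab : G.Adj a b := by simpa using he
    rw [← Finset.card_filter, ← card_filter_triples hab.ne]
    simp
  rw [← h1, Finset.sum_congr rfl fun T _ => h2 T, Finset.sum_comm, Nat.card_eq_fintype_card,
    ← SimpleGraph.edgeFinset_card, mul_comm 2, ← smul_eq_mul (G.edgeFinset.card),
    ← Finset.sum_const, ← Finset.sum_add_distrib, Finset.sum_congr rfl h3, Finset.sum_const,
    smul_eq_mul]

theorem card_triangle : Nat.card (Triangle G) = tripleCount G 3 := by
  classical
  rw [tripleCount_eq_card, Nat.card_eq_fintype_card, Fintype.card_subtype]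
  congr 1
  ext T
  simp only [Finset.mem_filter, Finset.mem_univ, true_and, Finset.mem_powersetCard_univ]
  constructor
  · exact fun h => ⟨h.card_eq, (ncard_edgesWithin_eq_three_iff G h.card_eq).2 h⟩
  · exact fun h => (ncard_edgesWithin_eq_three_iff G h.1).1 h.2

theorem card_free_triples : Nat.card {T : Finset V // T.card = 3 ∧ ∀ a ∈ T, ∀ b ∈ T, ¬ G.Adj a b} =
    tripleCount G 0 := by
  classical
  rw [tripleCount_eq_card, Nat.card_eq_fintype_card, Fintype.card_subtype]
  congr 1
  ext T
  simp only [Finset.mem_filter, Finset.mem_univ, true_and, Finset.mem_powersetCard_univ,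
    ncard_edgesWithin_eq_zero_iff]

open Classical in
theorem distTwoCount_eq_card : distTwoCount G =
    (Finset.univ.filter fun p : V × V => G.edist p.1 p.2 = 2).card := by
  rw [distTwoCount, ← Set.ncard_coe_finset]
  simp

open Classical in
theorem distGeThreeCount_eq_card : distGeThreeCount G =
    (Finset.univ.filter fun p : V × V => 3 ≤ G.edist p.1 p.2).card := by
  rw [distGeThreeCount, ← Set.ncard_coe_finset]
  simp

/-- Ordered pairs of distinct vertices are at distance one, two, or at least three; each edge
accounts for two of the first kind. -/
theorem card_pairs : Nat.card {p : V × V // p.1 ≠ p.2} =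
    2 * Nat.card G.edgeSet + distTwoCount G + distGeThreeCount G := by
  classical
  have h1 : (Finset.univ.filter fun p : V × V => G.Adj p.1 p.2).card = 2 * Nat.card G.edgeSet := by
    rw [Nat.card_eq_fintype_card, ← SimpleGraph.edgeFinset_card,
      ← SimpleGraph.sum_degrees_eq_twice_card_edges, Finset.card_filter, Fintype.sum_prod_type]
    refine Finset.sum_congr rfl fun a _ => ?_
    rw [← Finset.card_filter, ← SimpleGraph.card_neighborFinset_eq_degree,
      SimpleGraph.neighborFinset_eq_filter]
  rw [← h1, distTwoCount_eq_card, distGeThreeCount_eq_card,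
    Nat.card_eq_fintype_card, Fintype.card_subtype,
    ← Finset.card_union_of_disjoint, ← Finset.card_union_of_disjoint]
  · congr 1
    ext ⟨a, b⟩
    simp only [Finset.mem_filter, Finset.mem_univ, true_and, Finset.mem_union,
      edist_eq_two_iff_exists, three_le_edist_iff]
    constructor
    · intro hab
      by_cases h : G.Adj a b
      · exact Or.inl (Or.inl h)
      · by_cases hq : ∃ q, G.Adj q a ∧ G.Adj q b
        · exact Or.inl (Or.inr ⟨hab, h, hq⟩)
        · exact Or.inr ⟨hab, h, hq⟩
    · rintro ((h | h) | h)
      exacts [h.ne, h.1, h.1]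
  · rw [Finset.disjoint_left]
    rintro ⟨a, b⟩ h
    simp only [Finset.mem_filter, Finset.mem_univ, true_and, Finset.mem_union,
      edist_eq_two_iff_exists, three_le_edist_iff] at h ⊢
    rcases h with h | h
    · exact fun h' => h'.2.1 h
    · exact fun h' => h'.2.2 h.2.2
  · rw [Finset.disjoint_left]
    rintro ⟨a, b⟩ h
    simp only [Finset.mem_filter, Finset.mem_univ, true_and,
      edist_eq_two_iff_exists] at h ⊢
    tauto

open Classical in
theorem distTwoCount_eq_two_mul (o : V ↪ ℕ) : distTwoCount G =
    2 * (Finset.univ.filter fun p : V × V => G.edist p.1 p.2 = 2 ∧ o p.1 < o p.2).card := by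
  have h : (Finset.univ.filter fun p : V × V => G.edist p.1 p.2 = 2 ∧ ¬ o p.1 < o p.2).card =
      (Finset.univ.filter fun p : V × V => G.edist p.1 p.2 = 2 ∧ o p.1 < o p.2).card := by
    refine Finset.card_bij (fun p _ => p.swap) ?_ ?_ ?_
    · rintro ⟨a, b⟩ h
      simp only [Finset.mem_filter, Finset.mem_univ, true_and, Prod.swap] at h ⊢
      rw [SimpleGraph.edist_comm]
      have : o a ≠ o b := o.injective.ne ((edist_eq_two_iff_exists G).1 h.1).1
      exact ⟨h.1, by omega⟩
    · intro p _ q _ h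
      exact Prod.swap_injective h
    · rintro ⟨a, b⟩ h
      simp only [Finset.mem_filter, Finset.mem_univ, true_and] at h
      refine ⟨(b, a), ?_, rfl⟩
      simp only [Finset.mem_filter, Finset.mem_univ, true_and]
      rw [SimpleGraph.edist_comm]
      exact ⟨h.1, by omega⟩
  rw [distTwoCount_eq_card, two_mul, ← Finset.card_filter_add_card_filter_not
    (s := Finset.univ.filter fun p : V × V => G.edist p.1 p.2 = 2) (fun p => o p.1 < o p.2),
    Finset.filter_filter, Finset.filter_filter, h]

theorem card_freePairs (o : V ↪ ℕ) : Nat.card {p : V × V // IsFreePair G o p.1 p.2} =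
    distTwoCount G / 2 + distGeThreeCount G := by
  classical
  rw [distTwoCount_eq_two_mul G o, Nat.mul_div_cancel_left _ two_pos, distGeThreeCount_eq_card,
    Nat.card_eq_fintype_card, Fintype.card_subtype, ← Finset.card_union_of_disjoint]
  · congr 1
    ext ⟨a, b⟩
    rw [Finset.mem_union, Finset.mem_filter, Finset.mem_filter, Finset.mem_filter]
    simp only [Finset.mem_univ, true_and, IsFreePair, edist_eq_two_iff_exists, three_le_edist_iff]
    by_cases hq : ∃ q, G.Adj q a ∧ G.Adj q b
    · simp [hq, and_assoc]
    · simp [hq]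
  · rw [Finset.disjoint_left]
    rintro ⟨a, b⟩ h
    simp only [Finset.mem_filter, Finset.mem_univ, true_and,
      edist_eq_two_iff_exists, three_le_edist_iff] at h ⊢
    exact fun h' => h'.2.2 h.1.2.2

theorem card_freeIndex (o : V ↪ ℕ) : Nat.card (FreeIndex G o) =
    tripleCount G 0 + distTwoCount G / 2 + distGeThreeCount G := by
  rw [Nat.card_sum, card_free_triples, card_freePairs, add_assoc]

/-- Write E for the number of edges. C^1 has rank E(v-1), C^0 has rank
t_0+t_1+t_2+t_3+2E+d_2+d_{≥3}, and there are sq+2t_3 cells of dimension two. Substituting E(v-2) =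
t_1+2t_2+3t_3, both sides equal t_2+2t_3-d_2/2. -/
theorem rank_identity :
    ((Nat.card (Σ e : G.edgeSet, Comp G {e}) : ℕ) : ℤ) - Nat.card (TriplePair V) +
      Nat.card G.edgeSet +
      (tripleCount G 0 + distTwoCount G / 2 + distGeThreeCount G : ℕ) =
    (Nat.card (FourCycle G ⊕ Triangle G × Bool) : ℕ) +
      ((tripleCount G 2 : ℤ) - ((distTwoCount G / 2 : ℕ) : ℤ) - (squareCount G : ℤ)) := by
  classical
  have h1 : Nat.card (Σ e : G.edgeSet, Comp G {e}) + Nat.card G.edgeSet =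
      Nat.card G.edgeSet * Fintype.card V := by
    rw [Nat.card_sigma, Nat.card_eq_fintype_card (α := G.edgeSet), ← Finset.card_univ,
      ← smul_eq_mul (Finset.card _) (Fintype.card V), ← Finset.sum_const, Finset.card_eq_sum_ones,
      ← Finset.sum_add_distrib]
    refine Finset.sum_congr rfl fun e _ => ?_
    rw [Nat.card_eq_fintype_card, card_comp_singleton]
  have h2 : Nat.card (TriplePair V) = _ := Nat.card_sum
  rw [← tripleCount_sum G, card_pairs G] at h2
  have h3 := sum_tripleCount G
  have h4 : Nat.card (FourCycle G ⊕ Triangle G × Bool) = _ := Nat.card_sum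
  rw [Nat.card_prod, card_triangle, Nat.card_eq_fintype_card (α := Bool), Fintype.card_bool,
    ← squareCount] at h4
  -- Evenness of `distTwoCount` makes the natural-number division exact.
  have h5 := distTwoCount_eq_two_mul G ((Fintype.equivFin V).toEmbedding.trans Fin.valEmbedding)
  rw [h2, h4]
  push_cast
  omega

end Counting

/-! ### The chromatic and cellular groups as kernels and cokernels -/

section Main

/-- The quotient by a submodule, computed inside a submodule that is everything. -/
def quotientSubmoduleOfEquiv {M : Type*} [AddCommGroup M] {S R : Submodule ℤ M} (hS : S = ⊤) :
    (S ⧸ R.submoduleOf S) ≃ₗ[ℤ] M ⧸ R :=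
  Submodule.Quotient.equiv _ _ (LinearEquiv.ofTop S hS) (by
    subst hS
    ext x
    constructor
    · rintro ⟨y, hy, rfl⟩
      exact hy
    · intro hx
      exact ⟨⟨x, trivial⟩, hx, rfl⟩)

/-- The quotient by a zero submodule. -/
def quotientBotEquiv {M : Type*} [AddCommGroup M] {S R : Submodule ℤ M} (hR : R = ⊥) :
    (S ⧸ R.submoduleOf S) ≃ₗ[ℤ] S :=
  Submodule.quotEquivOfEqBot _ (by
    subst hR
    rw [Submodule.submoduleOf, Submodule.comap_bot, Submodule.ker_subtype])

theorem range_dualMap_eq_bot {M N : Type*} [AddCommGroup M] [AddCommGroup N] {f : M →ₗ[ℤ] N}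
    (hf : f = 0) : LinearMap.range f.dualMap = ⊥ := by
  rw [LinearMap.range_eq_bot]
  exact LinearMap.ext fun φ => LinearMap.ext fun x => by simp [hf]

theorem map_mem_torsion {A B : Type*} [AddCommGroup A] [AddCommGroup B] (e : A →ₗ[ℤ] B) {x : A}
    (hx : x ∈ Submodule.torsion ℤ A) : e x ∈ Submodule.torsion ℤ B := by
  rw [Submodule.mem_torsion_iff] at hx ⊢
  obtain ⟨a, ha⟩ := hx
  refine ⟨a, ?_⟩
  rw [Submonoid.smul_def] at ha ⊢
  rw [← map_smul, ha, map_zero]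

/-- A linear equivalence restricts to the torsion submodules. -/
def torsionEquiv {A B : Type*} [AddCommGroup A] [AddCommGroup B] (e : A ≃ₗ[ℤ] B) :
    Submodule.torsion ℤ A ≃ₗ[ℤ] Submodule.torsion ℤ B :=
  e.ofSubmodules _ _ (le_antisymm
    (Submodule.map_le_iff_le_comap.2 fun _ hx => map_mem_torsion e.toLinearMap hx)
    fun x hx => ⟨e.symm x, map_mem_torsion e.symm.toLinearMap hx, e.apply_symm_apply x⟩)

variable {V : Type u} [Fintype V] (G : SimpleGraph V) (ord : G.edgeSet ↪ ℕ) {j : ℤ}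

/-- The target is zero. Hence all 1-cochains are cocycles and no nonzero 1-cycle bounds, so the
groups in index one are a plain cokernel and a plain kernel. -/
theorem gradedDifferential_one_eq_zero (hj : j = 2 * (Fintype.card V : ℤ) - 3) :
    gradedDifferential G ord 3 1 j = 0 := by
  have := Submodule.subsingleton_iff_eq_bot.2 (gradedCochain_two_eq_bot G hj)
  exact LinearMap.ext fun x => Subsingleton.elim _ _

def cohomologyZeroEquiv : Cohomology G ord 3 0 j ≃ₗ[ℤ]
    LinearMap.ker (gradedDifferential G ord 3 0 j) :=
  quotientBotEquiv rfl

def cohomologyOneEquiv (hj : j = 2 * (Fintype.card V : ℤ) - 3) : Cohomology G ord 3 1 j ≃ₗ[ℤ]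
    gradedCochain G 3 1 j ⧸ LinearMap.range (gradedDifferential G ord 3 0 j) :=
  quotientSubmoduleOfEquiv (by rw [gradedDifferential_one_eq_zero G ord hj, LinearMap.ker_zero])

def homologyZeroEquiv : Homology G ord 3 0 j ≃ₗ[ℤ]
    Module.Dual ℤ (gradedCochain G 3 0 j) ⧸
      LinearMap.range (gradedDifferential G ord 3 0 j).dualMap :=
  quotientSubmoduleOfEquiv rfl

def homologyOneEquiv (hj : j = 2 * (Fintype.card V : ℤ) - 3) : Homology G ord 3 1 j ≃ₗ[ℤ]
    LinearMap.ker (gradedDifferential G ord 3 0 j).dualMap :=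
  quotientBotEquiv (range_dualMap_eq_bot (gradedDifferential_one_eq_zero G ord hj))

variable {G} (c : CellChoice G)

omit [Fintype V] in
-- All vertices are identified, so every 1-cell is a loop; H_1 and H^1 are then the cokernel of the
-- 2-cell boundary and the kernel of its dual.
theorem boundary1_eq_zero : c.cellComplex.boundary1 = 0 := by
  refine Finsupp.lhom_ext' fun e => LinearMap.ext_ring ?_
  refine (Finsupp.linearCombination_single ℤ _ _).trans ?_
  have : c.cellComplex.tgt e = c.cellComplex.src e := Subsingleton.elim (α := Trunc V) _ _
  rw [this, sub_self, smul_zero]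
  rfl

def cellHomologyOneEquiv : c.cellComplex.homology1 ≃ₗ[ℤ]
    (G.edgeSet →₀ ℤ) ⧸ LinearMap.range c.boundary :=
  quotientSubmoduleOfEquiv (M := G.edgeSet →₀ ℤ)
    (by rw [boundary1_eq_zero]; exact LinearMap.ker_zero)

def cellCohomologyOneEquiv : c.cellComplex.cohomology1 ≃ₗ[ℤ] LinearMap.ker c.boundary.dualMap :=
  quotientBotEquiv (M := Module.Dual ℤ (G.edgeSet →₀ ℤ))
    (range_dualMap_eq_bot (boundary1_eq_zero c))

open Module in
theorem nonempty_homologyZero_equiv (hj : j = 2 * (Fintype.card V : ℤ) - 3) {n : ℕ}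
    (hn : n = tripleCount G 0 + distTwoCount G / 2 + distGeThreeCount G) :
    Nonempty ((Dual ℤ (gradedCochain G 3 0 j) ⧸
      LinearMap.range (gradedDifferential G ord 3 0 j).dualMap) ≃ₗ[ℤ]
      ((G.edgeSet →₀ ℤ) ⧸ LinearMap.range c.boundary) × (Fin n → ℤ)) := by
  classical
  -- Any numbering of the vertices will do; it only selects one order of each pair at distance two.
  let o : V ↪ ℕ := (Fintype.equivFin V).toEmbedding.trans Fin.valEmbedding
  obtain ⟨e⟩ := nonempty_presentation_equiv o c (basisZero G hj).dualBasis
  rw [Module.Basis.coe_dualBasis, ← range_dualMap_differential G ord hj] at e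
  have hcard : Nat.card (FreeIndex G o) = n := (card_freeIndex G o).trans hn.symm
  let f : (FreeIndex G o →₀ ℤ) ≃ₗ[ℤ] (Fin n → ℤ) :=
    (Finsupp.linearEquivFunOnFinite ℤ ℤ (FreeIndex G o)).trans
      (LinearEquiv.funCongrLeft ℤ ℤ (Finite.equivFinOfCardEq hcard).symm)
  exact ⟨e.trans ((LinearEquiv.refl ℤ _).prodCongr f)⟩

end Main

end ChromaticHomology

end

theorem theorem4p1 {V : Type*} [Fintype V] (G : SimpleGraph V)
    -- the choices in the constructions: an ordering of the edges, and the data of the cells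
    (ord : G.edgeSet ↪ ℕ) (c : ChromaticHomology.CellChoice G)
    (j : ℤ) (hj : j = 2 * (Fintype.card V : ℤ) - 3)
    (n : ℕ) (hn : n = ChromaticHomology.tripleCount G 0 + ChromaticHomology.distTwoCount G / 2 +
      ChromaticHomology.distGeThreeCount G)
    (r : ℤ) (hr : r = (ChromaticHomology.tripleCount G 2 : ℤ) -
      ((ChromaticHomology.distTwoCount G / 2 : ℕ) : ℤ) - (ChromaticHomology.squareCount G : ℤ)) :
    -- `H^{0,2v-3}` is free, and isomorphic to `H^1(X) ⊕ ℤ^n`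
    (Module.Free ℤ (ChromaticHomology.Cohomology G ord 3 0 j) ∧
      Nonempty (ChromaticHomology.Cohomology G ord 3 0 j ≃+
        c.cellComplex.cohomology1 × (Fin n → ℤ))) ∧
    -- `H^{1,2v-3} = H^2(X) ⊕ ℤ^r`, where `r` may be negative: the torsion parts and the ranks,
    -- and the isomorphism with the negative part of the exponent moved to the other side
    (Module.Finite ℤ (ChromaticHomology.Cohomology G ord 3 1 j) ∧
      Module.Finite ℤ c.cellComplex.cohomology2 ∧
      Nonempty (Submodule.torsion ℤ (ChromaticHomology.Cohomology G ord 3 1 j) ≃+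
        Submodule.torsion ℤ c.cellComplex.cohomology2) ∧
      (Module.finrank ℤ (ChromaticHomology.Cohomology G ord 3 1 j) : ℤ) =
        (Module.finrank ℤ c.cellComplex.cohomology2 : ℤ) + r ∧
      ∀ a b : ℕ, (a : ℤ) - b = r →
        Nonempty (ChromaticHomology.Cohomology G ord 3 1 j × (Fin b → ℤ) ≃+
          c.cellComplex.cohomology2 × (Fin a → ℤ))) ∧
    -- `H_{0,2v-3}` is isomorphic to `H_1(X) ⊕ ℤ^n`
    Nonempty (ChromaticHomology.Homology G ord 3 0 j ≃+
      c.cellComplex.homology1 × (Fin n → ℤ)) ∧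
    -- `H_{1,2v-3}` is free, and `H_{1,2v-3} = H_2(X) ⊕ ℤ^r`
    (Module.Free ℤ (ChromaticHomology.Homology G ord 3 1 j) ∧
      Module.Finite ℤ (ChromaticHomology.Homology G ord 3 1 j) ∧
      ∀ a b : ℕ, (a : ℤ) - b = r →
        Nonempty (ChromaticHomology.Homology G ord 3 1 j × (Fin b → ℤ) ≃+
          c.cellComplex.homology2 × (Fin a → ℤ))) := by
  have e0 := ChromaticHomology.cohomologyZeroEquiv G ord (j := j)
  have e1 := ChromaticHomology.cohomologyOneEquiv G ord hj
  have f0 := ChromaticHomology.homologyZeroEquiv G ord (j := j)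
  have f1 := ChromaticHomology.homologyOneEquiv G ord hj
  have x1 := ChromaticHomology.cellHomologyOneEquiv c
  have y1 := ChromaticHomology.cellCohomologyOneEquiv c
  have b0 := ChromaticHomology.basisZero G hj
  have b1 := ChromaticHomology.basisOne G hj
  have : Module.Free ℤ (ChromaticHomology.gradedCochain G 3 0 j) := .of_basis b0
  have : Module.Finite ℤ (ChromaticHomology.gradedCochain G 3 0 j) := .of_basis b0
  have : Module.Free ℤ (ChromaticHomology.gradedCochain G 3 1 j) := .of_basis b1
  have : Module.Finite ℤ (ChromaticHomology.gradedCochain G 3 1 j) := .of_basis b1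
  obtain ⟨e⟩ := ChromaticHomology.nonempty_homologyZero_equiv ord c hj hn
  -- The isomorphism `e` for the homology in index zero determines the other three groups; what is
  -- left is the rank count.
  obtain ⟨⟨k1⟩, ⟨k2⟩, k3, k4, k5⟩ := ChromaticHomology.homology_compare
    (ChromaticHomology.gradedDifferential G ord 3 0 j) c.boundary n r e (by
      rw [Module.finrank_eq_nat_card_basis b0, Module.finrank_eq_nat_card_basis b1,
        Module.finrank_eq_nat_card_basis (Finsupp.basisSingleOne (R := ℤ) (ι := G.edgeSet)),
        Module.finrank_eq_nat_card_basis (Finsupp.basisSingleOne (R := ℤ)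
          (ι := ChromaticHomology.FourCycle G ⊕ ChromaticHomology.Triangle G × Bool)), hn, hr]
      exact ChromaticHomology.rank_identity G)
  have y2 : c.cellComplex.cohomology2 ≃ₗ[ℤ]
      Module.Dual ℤ (ChromaticHomology.FourCycle G ⊕ ChromaticHomology.Triangle G × Bool →₀ ℤ) ⧸
        LinearMap.range c.boundary.dualMap := LinearEquiv.refl ℤ _
  have x2 : c.cellComplex.homology2 ≃ₗ[ℤ] LinearMap.ker c.boundary := LinearEquiv.refl ℤ _
  refine ⟨⟨.of_equiv e0.symm, ⟨(e0.trans (k1.trans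
    (y1.symm.prodCongr (LinearEquiv.refl ℤ (Fin n → ℤ))))).toAddEquiv⟩⟩,
    ⟨.equiv e1.symm, .equiv y2.symm, ⟨((ChromaticHomology.torsionEquiv e1).trans
      (k2.trans (ChromaticHomology.torsionEquiv y2).symm)).toAddEquiv⟩, ?_, ?_⟩,
    ⟨(f0.trans (e.trans (x1.symm.prodCongr (LinearEquiv.refl ℤ (Fin n → ℤ))))).toAddEquiv⟩,
    ⟨.of_equiv f1.symm, .equiv f1.symm, ?_⟩⟩
  · rw [e1.finrank_eq, y2.finrank_eq]
    exact k3
  · intro a b hab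
    obtain ⟨k⟩ := k4 a b hab
    exact ⟨((e1.prodCongr (LinearEquiv.refl ℤ (Fin b → ℤ))).trans
      (k.trans (y2.symm.prodCongr (LinearEquiv.refl ℤ (Fin a → ℤ))))).toAddEquiv⟩
  · intro a b hab
    obtain ⟨k⟩ := k5 a b hab
    exact ⟨((f1.prodCongr (LinearEquiv.refl ℤ (Fin b → ℤ))).trans
      (k.trans (x2.symm.prodCongr (LinearEquiv.refl ℤ (Fin a → ℤ))))).toAddEquiv⟩
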